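/- Let $(Q,\mathfrak m,\mathsf k)$ be a commutative Noetherian local ring whose residue field $\mathsf k=Q/\mathfrak m$ has characteristic $0$. Let $(f,g)$ be an exact pair of zero divisors in $Q$, that is, $f,g\in Q$ are nonzero elements with $\mathrm{ann}_Q(f)=(g)$ and $\mathrm{ann}_Q(g)=(f)$, and set $R=Q/(f)$. Let $M,N$ be finitely generated $R$-modules such that $gN=0$ and $M\otimes_Q N$ has finite length. For $A\in\{Q,R\}$ let $\ell_A$ denote the length of an $A$-module. Then $\mathrm{Tor}^A_n(M,N)$ has finite length over $A$ for all $n\ge 0$. Put $\beta^A_n=\ell_A(\mathrm{Tor}_n^A(M,N))$ and define the length complexity $\ell\mathrm{cx}_A(M,N)\in\{0,1,2,\dots\}\cup\{\infty\}$ as the complexity of the series $\sum_{n\ge0}\beta^A_nt^n$: $$\ell\mathrm{cx}_A(M,N)=\inf\{c\in\mathbb Z_{\ge0}\colon \text{there is } \alpha>0 \text{ such that } \beta_n^A\le \alpha n^{c-1} \text{ for all } n\gg0\},$$ with $\inf\emptyset=\infty$. Then $$\ell\mathrm{cx}_Q(M,N)-1\le \ell\mathrm{cx}_R(M,N)\le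 \ell\mathrm{cx}_Q(M,N)+1,$$ where $\infty\pm1=\infty$. -/

import Mathlib

open CategoryTheory TensorProduct Filter

universe u

/-- `(f, g)` is an exact pair of zero divisors: `f` and `g` are nonzero, `ann f = (g)` and
`ann g = (f)`. -/
structure IsExactPair {Q : Type*} [CommRing Q] (f g : Q) : Prop where
  left_ne_zero : f ≠ 0
  right_ne_zero : g ≠ 0
  ann_left : ∀ a : Q, a * f = 0 ↔ a ∈ Ideal.span {g}
  ann_right : ∀ a : Q, a * g = 0 ↔ a ∈ Ideal.span {f}

/-- The length (in `ℕ∞`) of the `A`-module `Tor_n^A(M, N)`. The functor `Tor'` is computed from a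
projective resolution of its first argument `M`, tensored with `N`. -/
noncomputable def torLength (A : Type u) [CommRing A] (M N : Type u) [AddCommGroup M] [Module A M]
    [AddCommGroup N] [Module A N] (n : ℕ) : ℕ∞ :=
  Module.length A (((Tor' (ModuleCat.{u} A) n).obj (ModuleCat.of A M)).obj (ModuleCat.of A N))

/-- The Poincaré series `∑ ℓ(Tor_n^A(M, N)) t^n` of a pair of modules all of whose Tor modules have
finite length. -/
noncomputable def poincareSeries (A : Type u) [CommRing A] (M N : Type u) [AddCommGroup M]
    [Module A M] [AddCommGroup N] [Module A N] : PowerSeries ℝ :=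
  PowerSeries.mk fun n => ((torLength A M N n).toNat : ℝ)

/-- The complexity of a real power series `∑ aₙ tⁿ`: the infimum, in `ℕ∞`, of the integers `c ≥ 0`
for which there is `α > 0` with `|aₙ| ≤ α n ^ (c - 1)` for all large `n` (it is `⊤` if there is no
such `c`). The exponent `c - 1` is an integer, equal to `-1` for `c = 0`. -/
noncomputable def seriesComplexity (p : PowerSeries ℝ) : ℕ∞ :=
  sInf {x : ℕ∞ | ∃ c : ℕ, x = (c : ℕ∞) ∧ ∃ α : ℝ, 0 < α ∧
    ∀ᶠ n : ℕ in atTop, |PowerSeries.coeff n p| ≤ α * (n : ℝ) ^ ((c : ℤ) - 1)}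

/-- The length complexity of the pair `(M, N)` over `A`. -/
noncomputable def lengthComplexity (A : Type u) [CommRing A] (M N : Type u) [AddCommGroup M]
    [Module A M] [AddCommGroup N] [Module A N] : ℕ∞ :=
  seriesComplexity (poincareSeries A M N)

/-- A prime containing the annihilator of a finitely generated Artinian module is maximal. -/
theorem Ideal.IsPrime.isMaximal_of_annihilator_le {A M : Type*} [CommRing A] [AddCommGroup M]
    [Module A M] [Module.Finite A M] [IsArtinian A M] {p : Ideal A} [hp : p.IsPrime]
    (h : Module.annihilator A M ≤ p) : p.IsMaximal := by
  obtain ⟨s, hs⟩ := Module.Finite.fg_top (R := A) (M := M)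
  let φ : A →ₗ[A] (s → M) := LinearMap.pi fun m => LinearMap.toSpanSingleton A M m
  have hφ : LinearMap.ker φ ≤ p := by
    refine le_trans (fun a ha => ?_) h
    rw [← Submodule.annihilator_top, ← hs, Submodule.mem_annihilator_span]
    intro m
    exact congrFun (LinearMap.mem_ker.1 ha) m
  have : IsArtinian A (A ⧸ LinearMap.ker φ) :=
    isArtinian_of_injective _
      (LinearMap.ker_eq_bot.1 ((LinearMap.ker φ).ker_liftQ_eq_bot' φ rfl))
  have : IsArtinian A (A ⧸ p) := isArtinian_of_surjective _ _ (Submodule.factor_surjective hφ)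
  have : IsArtinianRing (A ⧸ p) :=
    isArtinian_of_tower A inferInstance
  have := IsArtinianRing.isField_of_isDomain (A ⧸ p)
  exact Ideal.Quotient.maximal_of_isField _ this

theorem Module.support_inter_subset_support_tensorProduct {A M N : Type*} [CommRing A]
    [AddCommGroup M] [AddCommGroup N] [Module A M] [Module A N] [Module.Finite A M]
    [Module.Finite A N] :
    Module.support A M ∩ Module.support A N ⊆ Module.support A (M ⊗[A] N) := by
  rintro p ⟨hM, hN⟩
  rw [Module.mem_support_iff_nontrivial_residueField_tensorProduct] at hM hN ⊢
  exact (AlgebraTensorModule.distribBaseChange A p.asIdeal.ResidueField M N).nontrivial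

/-- A finitely generated module over a Noetherian ring that is annihilated by the annihilators of
`M` and `N` has finite length if `M ⊗ N` has. -/
theorem Module.length_ne_top_of_annihilator_le {A M N T : Type*} [CommRing A] [IsNoetherianRing A]
    [AddCommGroup M] [AddCommGroup N] [AddCommGroup T] [Module A M] [Module A N] [Module A T]
    [Module.Finite A M] [Module.Finite A N] [Module.Finite A T]
    (hMN : Module.length A (M ⊗[A] N) ≠ ⊤)
    (hM : Module.annihilator A M ≤ Module.annihilator A T)
    (hN : Module.annihilator A N ≤ Module.annihilator A T) : Module.length A T ≠ ⊤ := by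
  have : IsArtinian A (M ⊗[A] N) := by
    have h := Module.length_ne_top_iff.1 hMN
    exact (isFiniteLength_iff_isNoetherian_isArtinian.1 h).2
  let I := Module.annihilator A T
  have hdim : Ring.KrullDimLE 0 (A ⧸ I) := by
    refine Ring.KrullDimLE.mk₀ fun J hJ => ?_
    have hle : I ≤ J.comap (Ideal.Quotient.mk I) := by
      intro a ha
      rw [Ideal.mem_comap, Ideal.Quotient.eq_zero_iff_mem.2 ha]
      exact J.zero_mem
    have hp : (J.comap (Ideal.Quotient.mk I)).IsPrime := Ideal.comap_isPrime _ _
    have hsupp : (⟨_, hp⟩ : PrimeSpectrum A) ∈ Module.support A (M ⊗[A] N) := by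
      apply Module.support_inter_subset_support_tensorProduct
      simp only [Set.mem_inter_iff, Module.mem_support_iff_of_finite]
      exact ⟨hM.trans hle, hN.trans hle⟩
    have hmax : (J.comap (Ideal.Quotient.mk I)).IsMaximal :=
      Ideal.IsPrime.isMaximal_of_annihilator_le (Module.annihilator_le_of_mem_support hsupp)
    rw [← Ideal.map_comap_of_surjective _ Ideal.Quotient.mk_surjective J]
    exact (Ideal.map_eq_top_or_isMaximal_of_surjective _ Ideal.Quotient.mk_surjective
      hmax).resolve_left (by
        rw [Ideal.map_comap_of_surjective _ Ideal.Quotient.mk_surjective J]; exact hJ.ne_top)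
  have : IsArtinianRing (A ⧸ I) := IsNoetherianRing.isArtinianRing_of_krullDimLE_zero
  let _ : Module (A ⧸ I) T := Module.quotientAnnihilator
  have : Module.Finite (A ⧸ I) T := Module.Finite.of_restrictScalars_finite A _ _
  rw [Module.length_eq_of_surjective (R := A ⧸ I) (S := A) (M := T) Ideal.Quotient.mk_surjective]
  exact Module.length_ne_top

/-- The length of the homology at `Y` of `X → Y → Z`. -/
noncomputable def homologyLength {A X Y Z : Type*} [CommRing A] [AddCommGroup X] [AddCommGroup Y]
    [AddCommGroup Z] [Module A X] [Module A Y] [Module A Z] (a : X →ₗ[A] Y) (b : Y →ₗ[A] Z) : ℕ∞ :=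
  Module.length A (LinearMap.ker b ⧸ (LinearMap.range a).submoduleOf (LinearMap.ker b))

theorem CategoryTheory.ShortComplex.length_homology {A : Type u} [CommRing A]
    (S : ShortComplex (ModuleCat.{u} A)) :
    Module.length A S.homology = homologyLength S.f.hom S.g.hom := by
  rw [S.moduleCatHomologyIso.toLinearEquiv.length_eq]
  have h : LinearMap.range S.moduleCatToCycles =
      (LinearMap.range S.f.hom).submoduleOf (LinearMap.ker S.g.hom) := by
    ext ⟨x, hx⟩
    simp [Submodule.submoduleOf, ShortComplex.moduleCatToCycles, Subtype.ext_iff]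
    rfl
  change Module.length A (LinearMap.ker S.g.hom ⧸ LinearMap.range S.moduleCatToCycles) = _
  rw [h]
  rfl

section Of

variable {A : Type u} [CommRing A] (X : ℕ → Type u) [∀ n, AddCommGroup (X n)] [∀ n, Module A (X n)]
  (d : ∀ n, X (n + 1) →ₗ[A] X n) (hd : ∀ n, d n ∘ₗ d (n + 1) = 0)

/-- The chain complex of modules with the given modules and differentials. -/
noncomputable def moduleComplex : ChainComplex (ModuleCat.{u} A) ℕ :=
  ChainComplex.of (fun n => ModuleCat.of A (X n)) (fun n => ModuleCat.ofHom (d n))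
    (fun n => by rw [← ModuleCat.ofHom_comp, hd]; rfl)

theorem moduleComplex_d (n : ℕ) : (moduleComplex X d hd).d (n + 1) n = ModuleCat.ofHom (d n) :=
  ChainComplex.of_d (fun n => ModuleCat.of A (X n)) (fun n => ModuleCat.ofHom (d n)) n

theorem length_homology_moduleComplex (n : ℕ) :
    Module.length A ((moduleComplex X d hd).homology (n + 1)) =
      homologyLength (d (n + 1)) (d n) := by
  refine (ShortComplex.homologyMapIso ((moduleComplex X d hd).isoSc' (n + 2) (n + 1) n
    (by simp) (by simp))).toLinearEquiv.length_eq.trans ?_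
  rw [ShortComplex.length_homology]
  change homologyLength ((moduleComplex X d hd).d (n + 2) (n + 1)).hom
    ((moduleComplex X d hd).d (n + 1) n).hom = _
  rw [moduleComplex_d, moduleComplex_d]
  rfl

variable {M : Type u} [AddCommGroup M] [Module A M] (ε : X 0 →ₗ[A] M)

/-- The projective resolution given by an exact sequence of projective modules. -/
noncomputable def moduleResolution [∀ n, Module.Projective A (X n)] (hε : Function.Surjective ε)
    (h₀ : Function.Exact (d 0) ε) (h : ∀ n, Function.Exact (d (n + 1)) (d n)) :
    ProjectiveResolution (ModuleCat.of A M) where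
  complex := moduleComplex X d fun n => (h n).linearMap_comp_eq_zero
  projective n := (IsProjective.iff_projective (X n)).1 inferInstance
  π := (ChainComplex.toSingle₀Equiv _ _).symm ⟨ModuleCat.ofHom ε, by
    rw [moduleComplex_d]; exact ModuleCat.hom_ext h₀.linearMap_comp_eq_zero⟩
  quasiIso := ⟨fun n => by
    cases n
    · rw [ChainComplex.quasiIsoAt₀_iff, ShortComplex.quasiIso_iff_of_zeros']
      · let S : ShortComplex (ModuleCat.{u} A) := ShortComplex.moduleCatMk (d 0) ε
          h₀.linearMap_comp_eq_zero
        refine (ShortComplex.exact_and_epi_g_iff_of_iso (S₂ := S) ?_).2 ⟨?_, ?_⟩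
        · exact ShortComplex.isoMk (Iso.refl _) (Iso.refl _) (Iso.refl _)
            ((Category.id_comp _).trans
              ((moduleComplex_d X d (fun n => (h n).linearMap_comp_eq_zero) 0).symm.trans
              (Category.comp_id _).symm))
            ((Category.id_comp _).trans (Eq.trans
              (ChainComplex.toSingle₀Equiv_symm_apply_f_zero
                (C := moduleComplex X d fun n => (h n).linearMap_comp_eq_zero)
                (ModuleCat.ofHom ε) _).symm (Category.comp_id _).symm))
        · exact (ShortComplex.ShortExact.moduleCat_exact_iff_function_exact S).2 h₀
        · exact (ModuleCat.epi_iff_surjective _).2 hε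
      all_goals rfl
    · rename_i n
      rw [quasiIsoAt_iff_exactAt']
      · rw [HomologicalComplex.exactAt_iff' _ (n + 2) (n + 1) n (by simp) (by simp)]
        refine (ShortComplex.ShortExact.moduleCat_exact_iff_function_exact _).2 ?_
        change Function.Exact
          ((moduleComplex X d fun n => (h n).linearMap_comp_eq_zero).d (n + 2) (n + 1)).hom
          ((moduleComplex X d fun n => (h n).linearMap_comp_eq_zero).d (n + 1) n).hom
        rw [moduleComplex_d, moduleComplex_d]
        exact h n
      · apply ChainComplex.exactAt_succ_single_obj⟩

end Of

section

variable {A : Type u} [CommRing A]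

theorem torLength_succ {M : Type u} [AddCommGroup M] [Module A M] (N : Type u) [AddCommGroup N]
    [Module A N] (X : ℕ → Type u) [∀ n, AddCommGroup (X n)] [∀ n, Module A (X n)]
    [∀ n, Module.Projective A (X n)]
    (d : ∀ n, X (n + 1) →ₗ[A] X n) (ε : X 0 →ₗ[A] M) (hε : Function.Surjective ε)
    (h₀ : Function.Exact (d 0) ε) (h : ∀ n, Function.Exact (d (n + 1)) (d n)) (n : ℕ) :
    torLength A M N (n + 1) =
      homologyLength ((d (n + 1)).rTensor N) ((d n).rTensor N) := by
  let P := moduleResolution X d ε hε h₀ h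
  let F := (MonoidalCategory.tensoringRight (ModuleCat.{u} A)).obj (ModuleCat.of A N)
  refine (P.isoLeftDerivedObj F (n + 1)).toLinearEquiv.length_eq.trans ?_
  refine (ShortComplex.homologyMapIso (((F.mapHomologicalComplex _).obj P.complex).isoSc'
    (n + 2) (n + 1) n (by simp) (by simp))).toLinearEquiv.length_eq.trans ?_
  rw [ShortComplex.length_homology]
  have hd (m : ℕ) : P.complex.d (m + 1) m = ModuleCat.ofHom (d m) := 
    moduleComplex_d X d (fun n => (h n).linearMap_comp_eq_zero) m
  change homologyLength (F.map (P.complex.d (n + 2) (n + 1))).hom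
    (F.map (P.complex.d (n + 1) n)).hom = _
  rw [hd, hd]
  rfl

theorem finite_tor' {M : Type u} [AddCommGroup M] [Module A M] (N : Type u) [AddCommGroup N]
    [Module A N] [IsNoetherianRing A] [Module.Finite A N]
    (P : ProjectiveResolution (ModuleCat.of A M)) (hP : ∀ n, Module.Finite A (P.complex.X n))
    (n : ℕ) :
    Module.Finite A (((Tor' (ModuleCat.{u} A) n).obj (.of A M)).obj (.of A N)) := by
  let F := (MonoidalCategory.tensoringRight (ModuleCat.{u} A)).obj (ModuleCat.of A N)
  let K := (F.mapHomologicalComplex _).obj P.complex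
  have : Module.Finite A (K.X n) :=
    inferInstanceAs (Module.Finite A (P.complex.X n ⊗[A] N))
  have : IsNoetherian A (K.sc n).X₂ := inferInstanceAs (IsNoetherian A (K.X n))
  have : Module.Finite A (LinearMap.ker (K.sc n).g.hom) := inferInstance
  have e : (((Tor' (ModuleCat.{u} A) n).obj (.of A M)).obj (.of A N)) ≅ _ :=
    (P.isoLeftDerivedObj F n) ≪≫ (K.sc n).moduleCatHomologyIso
  have : Module.Finite A (K.sc n).moduleCatLeftHomologyData.H :=
    Module.Finite.of_surjective (LinearMap.range (K.sc n).moduleCatToCycles).mkQ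
      (Submodule.mkQ_surjective _)
  exact Module.Finite.equiv e.toLinearEquiv.symm

theorem annihilator_right_le_annihilator_tor' {M : Type u} [AddCommGroup M] [Module A M]
    (N : Type u) [AddCommGroup N] [Module A N] (n : ℕ) :
    Module.annihilator A N ≤ Module.annihilator A
      (((Tor' (ModuleCat.{u} A) n).obj (.of A M)).obj (.of A N)) := by
  intro a ha
  let P := projectiveResolution (ModuleCat.of A M)
  let F := (MonoidalCategory.tensoringRight (ModuleCat.{u} A)).obj (ModuleCat.of A N)
  let K := (F.mapHomologicalComplex _).obj P.complex
  have e : (((Tor' (ModuleCat.{u} A) n).obj (.of A M)).obj (.of A N)) ≅ _ :=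
    (P.isoLeftDerivedObj F n) ≪≫ (K.sc n).moduleCatHomologyIso
  have h (x : P.complex.X n ⊗[A] N) : a • x = 0 := by
    induction x with
    | zero => simp
    | add x y hx hy => rw [smul_add, hx, hy, add_zero]
    | tmul x y => rw [← TensorProduct.tmul_smul, Module.mem_annihilator.1 ha, tmul_zero]
  have h' : a ∈ Module.annihilator A (LinearMap.ker (K.sc n).g.hom ⧸
      LinearMap.range (K.sc n).moduleCatToCycles) := by
    rw [Module.mem_annihilator]
    intro x
    obtain ⟨⟨x, hx⟩, rfl⟩ := Submodule.Quotient.mk_surjective _ x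
    rw [← Submodule.Quotient.mk_smul, Submodule.Quotient.mk_eq_zero]
    have : a • (⟨x, hx⟩ : LinearMap.ker (K.sc n).g.hom) = 0 := Subtype.ext (h x)
    rw [this]
    exact zero_mem _
  exact (e.toLinearEquiv.annihilator_eq).ge h'

theorem annihilator_left_le_annihilator_tor' {M : Type u} [AddCommGroup M] [Module A M]
    (N : Type u) [AddCommGroup N] [Module A N] (n : ℕ) :
    Module.annihilator A M ≤ Module.annihilator A
      (((Tor' (ModuleCat.{u} A) n).obj (.of A M)).obj (.of A N)) := by
  intro a ha
  let P := projectiveResolution (ModuleCat.of A M)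
  let F := (MonoidalCategory.tensoringRight (ModuleCat.{u} A)).obj (ModuleCat.of A N)
  let H := HomologicalComplex.homologyFunctor (ModuleCat.{u} A) (ComplexShape.down ℕ) n
  let Φ := (F.mapHomologicalComplex (ComplexShape.down ℕ))
  have hM : a • 𝟙 (ModuleCat.of A M) = 0 := by
    ext x
    exact Module.mem_annihilator.1 ha x
  have h₁ := Functor.leftDerived_map_eq F n (0 : ModuleCat.of A M ⟶ ModuleCat.of A M)
    (P := P) (Q := P) 0 (by simp)
  have h₂ := Functor.leftDerived_map_eq F n (0 : ModuleCat.of A M ⟶ ModuleCat.of A M)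
    (P := P) (Q := P) (a • 𝟙 _) (by
      rw [Functor.map_zero, Limits.comp_zero]
      refine HomologicalComplex.to_single_hom_ext ?_
      ext x
      change (P.π.f 0).hom (a • x) = 0
      rw [map_smul]
      exact Module.mem_annihilator.1 ha ((P.π.f 0).hom x))
  have h₀ : (Φ ⋙ H).map (0 : P.complex ⟶ P.complex) = 0 := by
    rw [Functor.comp_map, Functor.map_zero, Functor.map_zero]
  rw [h₀, Limits.zero_comp, Limits.comp_zero] at h₁
  have h₃ : (Φ ⋙ H).map (a • 𝟙 P.complex) = a • 𝟙
      ((HomologicalComplex.homologyFunctor (ModuleCat.{u} A) (ComplexShape.down ℕ) n).obj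
        ((F.mapHomologicalComplex (ComplexShape.down ℕ)).obj P.complex)) := by
    rw [Functor.comp_map, Functor.map_smul, CategoryTheory.Functor.map_id]
    change ShortComplex.homologyMap (a • 𝟙 ((Φ.obj P.complex).sc n)) = _
    rw [ShortComplex.homologyMap_smul, ShortComplex.homologyMap_id]
    rfl
  have h₄ : a • 𝟙 ((F.leftDerived n).obj (ModuleCat.of A M)) = 0 := by
    rw [← h₁, h₂, h₃, Linear.smul_comp, Linear.comp_smul, Category.id_comp, Iso.hom_inv_id]
  rw [Module.mem_annihilator]
  intro x
  exact congrArg (fun φ => φ.hom x) h₄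

variable (A) in
theorem exists_free_resolution (M : Type u) [AddCommGroup M] [Module A M] [IsNoetherianRing A]
    [Module.Finite A M] :
    ∃ (S : ℕ → Type u) (_ : ∀ n, Finite (S n)) (d : ∀ n, (S (n + 1) →₀ A) →ₗ[A] (S n →₀ A))
      (ε : (S 0 →₀ A) →ₗ[A] M), Function.Surjective ε ∧ Function.Exact (d 0) ε ∧
        ∀ n, Function.Exact (d (n + 1)) (d n) := by
  have key (M : ModuleCat.{u} A) : ∃ s : Set M, (Module.Finite A M → s.Finite) ∧
      Submodule.span A s = ⊤ := by
    by_cases h : Module.Finite A M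
    · obtain ⟨s, hs⟩ := h
      exact ⟨s, fun _ => s.finite_toSet, hs⟩
    · exact ⟨Set.univ, fun h' => (h h').elim, Submodule.span_univ⟩
  choose s hfin hspan using key
  let cover (M : ModuleCat.{u} A) : (s M →₀ A) →ₗ[A] M :=
    Finsupp.linearCombination A Subtype.val
  have hcover (M : ModuleCat.{u} A) : Function.Surjective (cover M) := by
    rw [← LinearMap.range_eq_top, Finsupp.range_linearCombination, Subtype.range_coe, hspan]
  let syz : ℕ → ModuleCat.{u} A := fun n =>
    Nat.rec (motive := fun _ => ModuleCat.{u} A) (ModuleCat.of A M)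
      (fun _ M => ModuleCat.of A (LinearMap.ker (cover M))) n
  have hsyz (n : ℕ) : Module.Finite A (syz n) := by
    induction n with
    | zero => exact inferInstanceAs (Module.Finite A M)
    | succ n ih =>
      have := (hfin _ ih).to_subtype
      exact inferInstanceAs (Module.Finite A (LinearMap.ker (cover (syz n))))
  have hker (n : ℕ) : Function.Exact ((LinearMap.ker (cover (syz n))).subtype ∘ₗ
      (cover (syz (n + 1)))) (cover (syz n)) := by
    intro x
    refine ⟨fun hx => ?_, ?_⟩
    · obtain ⟨y, hy⟩ := hcover (syz (n + 1)) ⟨x, hx⟩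
      exact ⟨y, congrArg Subtype.val hy⟩
    · rintro ⟨y, rfl⟩
      exact (cover (syz (n + 1)) y).2
  refine ⟨fun n => (s (syz n) : Set (syz n)), fun n => (hfin _ (hsyz n)).to_subtype,
    fun n => (LinearMap.ker (cover (syz n))).subtype ∘ₗ (cover (syz (n + 1))), cover _,
    hcover _, hker 0, fun n x => ?_⟩
  rw [← hker (n + 1) x]
  exact Submodule.coe_eq_zero

end

theorem Finsupp.map_mem_of_mem_supported {A ι V : Type*} [CommRing A] [AddCommGroup V] [Module A V]
    {s : Set ι} (T : (ι →₀ A) →ₗ[A] V) (P : Submodule A V)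
    (h : ∀ j ∈ s, T (Finsupp.single j 1) ∈ P) {w : ι →₀ A} (hw : w ∈ Finsupp.supported A A s) :
    T w ∈ P := by
  rw [Finsupp.supported_eq_span_single] at hw
  refine (Submodule.span_le (p := P.comap T)).2 ?_ hw
  rintro _ ⟨j, hj, rfl⟩
  exact h j hj

theorem Finsupp.map_eq_of_mem_supported {A ι V : Type*} [CommRing A] [AddCommGroup V] [Module A V]
    {s : Set ι} (T T' : (ι →₀ A) →ₗ[A] V)
    (h : ∀ j ∈ s, T (Finsupp.single j 1) = T' (Finsupp.single j 1)) {w : ι →₀ A}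
    (hw : w ∈ Finsupp.supported A A s) : T w = T' w := by
  have := Finsupp.map_mem_of_mem_supported (T - T') ⊥ (fun j hj => by simp [h j hj]) hw
  simpa [sub_eq_zero] using this

namespace Tate

/-- Indices of the basis elements `z ^ i * y ^ ε * x` of the free module over `Q⟨y, z⟩` on a graded
set. -/
abbrev Index (S : ℕ → Type u) := ℕ × Bool × (Σ n, S n)

/-- The total degree, for `y` of degree `1` and `z` of degree `2`. -/
def deg {S : ℕ → Type u} (j : Index S) : ℕ := 2 * j.1 + j.2.1.toNat + j.2.2.1

variable {Q : Type u} [CommRing Q] {S : ℕ → Type u}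

variable (Q) in
/-- The basis element `z ^ i * y ^ ε * x`. -/
noncomputable abbrev e (i : ℕ) (ε : Bool) (x : Σ n, S n) : Index S →₀ Q :=
  Finsupp.single (i, ε, x) 1

/-- Multiplication by `z`. -/
noncomputable def mulZ : (Index S →₀ Q) →ₗ[Q] (Index S →₀ Q) :=
  Finsupp.linearCombination Q fun j => e Q (j.1 + 1) j.2.1 j.2.2

/-- Multiplication by `y`. -/
noncomputable def mulY : (Index S →₀ Q) →ₗ[Q] (Index S →₀ Q) :=
  Finsupp.linearCombination Q fun j => if j.2.1 then 0 else e Q j.1 true j.2.2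

@[simp]
theorem mulZ_single (i : ℕ) (ε : Bool) (x : Σ n, S n) :
    mulZ (e Q i ε x) = e Q (i + 1) ε x := by
  simp [mulZ]

@[simp]
theorem mulY_single_false (i : ℕ) (x : Σ n, S n) :
    mulY (e Q i false x) = e Q i true x := by
  simp [mulY]

@[simp]
theorem mulY_single_true (i : ℕ) (x : Σ n, S n) : mulY (e Q i true x) = 0 := by
  simp [mulY]

theorem hom_ext {V : Type*} [AddCommGroup V] [Module Q V] {T T' : (Index S →₀ Q) →ₗ[Q] V}
    (h : ∀ i ε x, T (e Q i ε x) = T' (e Q i ε x)) : T = T' := by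
  refine Finsupp.lhom_ext' fun j => LinearMap.ext_ring ?_
  exact h j.1 j.2.1 j.2.2

theorem mulY_mulY (w : Index S →₀ Q) : mulY (mulY w) = 0 := by
  have : mulY ∘ₗ mulY = (0 : (Index S →₀ Q) →ₗ[Q] _) :=
    hom_ext fun i ε x => by cases ε <;> simp
  exact LinearMap.congr_fun this w

theorem mulZ_mulY (w : Index S →₀ Q) : mulZ (mulY w) = mulY (mulZ w) := by
  have : mulZ ∘ₗ mulY = mulY ∘ₗ (mulZ : (Index S →₀ Q) →ₗ[Q] _) :=
    hom_ext fun i ε x => by cases ε <;> simp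
  exact LinearMap.congr_fun this w

theorem mulZ_pow_mulY (i : ℕ) (w : Index S →₀ Q) :
    (mulZ ^ i) (mulY w) = mulY ((mulZ ^ i) w) := by
  induction i with
  | zero => simp
  | succ i ih => rw [pow_succ', Module.End.mul_apply, ih, mulZ_mulY, Module.End.mul_apply]

theorem mulZ_pow_succ (i : ℕ) (w : Index S →₀ Q) :
    (mulZ ^ (i + 1)) w = mulZ ((mulZ ^ i) w) := by
  rw [pow_succ', Module.End.mul_apply]

variable (f g : Q) (φ : (Σ n, S n) → (Index S →₀ Q))

/-- The differential that is linear over the differential graded algebra `Q⟨y, z⟩` with `∂ y = f`,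
`∂ z = g * y`, and maps a basis element `x` to `φ x`. -/
noncomputable def D : (Index S →₀ Q) →ₗ[Q] (Index S →₀ Q) :=
  Finsupp.linearCombination Q fun j =>
    if j.2.1 then f • e Q j.1 false j.2.2 - (mulZ ^ j.1) (mulY (φ j.2.2))
    else ((j.1 : Q) * g) • e Q (j.1 - 1) true j.2.2 + (mulZ ^ j.1) (φ j.2.2)

theorem D_true (i : ℕ) (x : Σ n, S n) :
    D f g φ (e Q i true x) = f • e Q i false x - (mulZ ^ i) (mulY (φ x)) := by
  simp [D]

theorem D_false (i : ℕ) (x : Σ n, S n) :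
    D f g φ (e Q i false x) = ((i : Q) * g) • e Q (i - 1) true x + (mulZ ^ i) (φ x) := by
  simp [D]

theorem D_false_zero (x : Σ n, S n) : D f g φ (e Q 0 false x) = φ x := by
  simp [D_false]

theorem D_mulZ (w : Index S →₀ Q) :
    D f g φ (mulZ w) = mulZ (D f g φ w) + g • mulY w := by
  have : D f g φ ∘ₗ mulZ = mulZ ∘ₗ D f g φ + g • mulY := by
    refine hom_ext fun i ε x => ?_
    cases ε
    · simp only [LinearMap.comp_apply, LinearMap.add_apply, LinearMap.smul_apply, mulZ_single,
        D_false, mulZ_pow_succ, map_add, map_smul, mulY_single_false, Nat.add_sub_cancel]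
      rcases i with _ | i
      · simp [add_comm]
      · simp only [Nat.add_sub_cancel]
        push_cast
        module
    · simp only [LinearMap.comp_apply, LinearMap.add_apply, LinearMap.smul_apply, mulZ_single,
        D_true, mulZ_pow_succ, map_sub, map_smul, mulY_single_true, smul_zero, add_zero]
  exact LinearMap.congr_fun this w

theorem D_mulY (w : Index S →₀ Q) :
    D f g φ (mulY w) = f • w - mulY (D f g φ w) := by
  have : D f g φ ∘ₗ mulY = f • LinearMap.id - mulY ∘ₗ D f g φ := by
    refine hom_ext fun i ε x => ?_
    cases ε
    · simp only [LinearMap.comp_apply, LinearMap.sub_apply, LinearMap.smul_apply, D_false, D_true,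
        LinearMap.id_apply, mulZ_pow_mulY, map_add, map_smul, mulY_single_true, mulY_single_false,
        smul_zero, zero_add]
    · simp only [LinearMap.comp_apply, LinearMap.sub_apply, LinearMap.smul_apply, D_true,
        LinearMap.id_apply, mulZ_pow_mulY, map_sub, map_smul, mulY_single_true, mulY_single_false,
        mulY_mulY, map_zero, sub_zero, sub_self]
  exact LinearMap.congr_fun this w

variable {f g}

theorem D_D_mulZ (hfg : f * g = 0) (w : Index S →₀ Q) :
    D f g φ (D f g φ (mulZ w)) = mulZ (D f g φ (D f g φ w)) := by
  rw [D_mulZ, map_add, D_mulZ, map_smul, D_mulY, smul_sub, smul_smul, mul_comm g f, hfg]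
  module

theorem D_D_mulY (w : Index S →₀ Q) :
    D f g φ (D f g φ (mulY w)) = mulY (D f g φ (D f g φ w)) := by
  rw [D_mulY, map_sub, D_mulY, map_smul]
  module

theorem D_D_single (hfg : f * g = 0) {x : Σ n, S n} (hx : D f g φ (φ x) = 0) (i : ℕ) (ε : Bool) :
    D f g φ (D f g φ (e Q i ε x)) = 0 := by
  have h₀ : D f g φ (D f g φ (e Q 0 ε x)) = 0 := by
    cases ε
    · rw [D_false_zero, hx]
    · rw [← mulY_single_false, D_D_mulY, D_false_zero, hx, map_zero]
  induction i with
  | zero => exact h₀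
  | succ i ih => rw [← mulZ_single, D_D_mulZ _ hfg, ih, map_zero]

variable (Q S) in
/-- The span of the basis elements of degree `n`. -/
noncomputable abbrev G (n : ℕ) : Submodule Q (Index S →₀ Q) :=
  Finsupp.supported Q Q {j | deg j = n}

variable (Q S) in
/-- The span of the basis elements of degree `n - 1`. -/
noncomputable abbrev G' (n : ℕ) : Submodule Q (Index S →₀ Q) :=
  Finsupp.supported Q Q {j | deg j + 1 = n}

variable (Q S) in
/-- The span of the basis elements `z ^ i * y ^ ε * x` with `x` of degree less than `p`. -/
noncomputable abbrev W (p : ℕ) : Submodule Q (Index S →₀ Q) :=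
  Finsupp.supported Q Q {j | j.2.2.1 < p}

theorem G'_succ (n : ℕ) : G' Q S (n + 1) = G Q S n := by
  simp [G', G]

theorem G'_zero : G' Q S 0 = ⊥ := by
  simp [G']

theorem G'_le_W (n : ℕ) : G' Q S n ≤ W Q S n :=
  Finsupp.supported_mono fun j (hj : deg j + 1 = n) => by
    simp only [deg] at hj
    change j.2.2.1 < n
    omega

theorem G_le_W {n p : ℕ} (h : n < p) : G Q S n ≤ W Q S p :=
  Finsupp.supported_mono fun j (hj : deg j = n) => by
    simp only [deg] at hj
    change j.2.2.1 < p
    omega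

theorem W_mono {p p' : ℕ} (h : p ≤ p') : W Q S p ≤ W Q S p' :=
  Finsupp.supported_mono fun j (hj : j.2.2.1 < p) => hj.trans_le h

theorem mulZ_mem_G' {n : ℕ} {w : Index S →₀ Q} (hw : w ∈ G' Q S n) :
    mulZ w ∈ G' Q S (n + 2) := by
  refine Finsupp.map_mem_of_mem_supported _ _ ?_ hw
  rintro ⟨i, ε, x⟩ hj
  rw [mulZ_single]
  refine Finsupp.single_mem_supported _ _ ?_
  simp only [deg, Set.mem_ofPred_eq] at hj ⊢
  omega

theorem mulZ_pow_mem_G' {n : ℕ} {w : Index S →₀ Q} (hw : w ∈ G' Q S n) (i : ℕ) :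
    (mulZ ^ i) w ∈ G' Q S (n + 2 * i) := by
  induction i with
  | zero => exact hw
  | succ i ih => rw [mulZ_pow_succ]; exact mulZ_mem_G' ih

theorem mulY_mem_G' {n : ℕ} {w : Index S →₀ Q} (hw : w ∈ G' Q S n) :
    mulY w ∈ G' Q S (n + 1) := by
  refine Finsupp.map_mem_of_mem_supported _ _ ?_ hw
  rintro ⟨i, ε, x⟩ hj
  cases ε
  · rw [mulY_single_false]
    refine Finsupp.single_mem_supported _ _ ?_
    simp only [deg, Set.mem_ofPred_eq, Bool.toNat_false, Bool.toNat_true] at hj ⊢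
    omega
  · rw [mulY_single_true]
    exact zero_mem _

theorem mulZ_pow_mem_W {n : ℕ} {w : Index S →₀ Q} (hw : w ∈ W Q S n) (i : ℕ) :
    (mulZ ^ i) w ∈ W Q S n := by
  induction i with
  | zero => exact hw
  | succ i ih =>
    rw [mulZ_pow_succ]
    refine Finsupp.map_mem_of_mem_supported _ _ ?_ ih
    rintro ⟨i, ε, x⟩ hj
    rw [mulZ_single]
    exact Finsupp.single_mem_supported _ _ hj

theorem mulY_mem_W {n : ℕ} {w : Index S →₀ Q} (hw : w ∈ W Q S n) : mulY w ∈ W Q S n := by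
  refine Finsupp.map_mem_of_mem_supported _ _ ?_ hw
  rintro ⟨i, ε, x⟩ hj
  cases ε
  · rw [mulY_single_false]
    exact Finsupp.single_mem_supported _ _ hj
  · rw [mulY_single_true]
    exact zero_mem _

theorem D_congr {φ φ' : (Σ n, S n) → (Index S →₀ Q)} {n : ℕ} (h : ∀ x, x.1 < n → φ x = φ' x)
    {w : Index S →₀ Q} (hw : w ∈ W Q S n) : D f g φ w = D f g φ' w := by
  refine Finsupp.map_eq_of_mem_supported _ _ ?_ hw
  rintro ⟨i, ε, x⟩ hj
  cases ε
  · rw [D_false, D_false, h x hj]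
  · rw [D_true, D_true, h x hj]

end Tate

namespace Tate

variable {Q : Type u} [CommRing Q] {S : ℕ → Type u} {f g : Q}

/-- The quotient map onto the degree `n` part of the complex over `Q ⧸ (f)`. -/
noncomputable def proj (f : Q) (n : ℕ) : (Index S →₀ Q) →ₗ[Q] (S n →₀ Q ⧸ Ideal.span {f}) :=
  Finsupp.mapRange.linearMap (Ideal.span {f}).mkQ ∘ₗ
    Finsupp.lcomapDomain (fun s => (0, false, ⟨n, s⟩)) (fun s t h => by simpa using h)

theorem proj_apply (n : ℕ) (w : Index S →₀ Q) (s : S n) :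
    proj f n w s = Ideal.Quotient.mk _ (w (0, false, ⟨n, s⟩)) := rfl

theorem proj_single (n : ℕ) (s : S n) :
    proj f n (e Q 0 false ⟨n, s⟩) = Finsupp.single s 1 := by
  classical
  ext t
  rw [proj_apply, Finsupp.single_apply, Finsupp.single_apply]
  simp only [Prod.mk.injEq, true_and, Sigma.mk.injEq, heq_eq_eq]
  split_ifs <;> simp

theorem proj_single_of_ne (n : ℕ) (j : Index S) (h : ∀ s, j ≠ (0, false, ⟨n, s⟩)) (a : Q) :
    proj f n (Finsupp.single j a) = 0 := by
  classical
  ext t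
  rw [proj_apply, Finsupp.single_apply, if_neg (h t)]
  simp

theorem proj_mulZ (n : ℕ) (w : Index S →₀ Q) : proj f n (mulZ w) = 0 := by
  have : proj f n ∘ₗ mulZ = (0 : (Index S →₀ Q) →ₗ[Q] _) := hom_ext fun i ε x => by
    rw [LinearMap.comp_apply, mulZ_single]
    exact proj_single_of_ne _ _ (by simp) _
  exact LinearMap.congr_fun this w

theorem proj_mulY (n : ℕ) (w : Index S →₀ Q) : proj f n (mulY w) = 0 := by
  have : proj f n ∘ₗ mulY = (0 : (Index S →₀ Q) →ₗ[Q] _) := hom_ext fun i ε x => by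
    rw [LinearMap.comp_apply]
    cases ε
    · rw [mulY_single_false]
      exact proj_single_of_ne _ _ (by simp) _
    · simp
  exact LinearMap.congr_fun this w

theorem proj_smul_self (n : ℕ) (w : Index S →₀ Q) : proj f n (f • w) = 0 := by
  ext t
  rw [proj_apply, Finsupp.smul_apply, Finsupp.zero_apply, Ideal.Quotient.eq_zero_iff_mem,
    smul_eq_mul]
  exact Ideal.mul_mem_right _ _ (Ideal.mem_span_singleton_self f)

theorem exists_lift (n : ℕ) (v : S n →₀ Q ⧸ Ideal.span {f}) : ∃ w ∈ G Q S n, proj f n w = v := by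
  induction v using Finsupp.induction_linear with
  | zero => exact ⟨0, zero_mem _, map_zero _⟩
  | add v v' h h' =>
    obtain ⟨w, hw, rfl⟩ := h
    obtain ⟨w', hw', rfl⟩ := h'
    exact ⟨w + w', add_mem hw hw', map_add _ _ _⟩
  | single s a =>
    obtain ⟨a, rfl⟩ := Ideal.Quotient.mk_surjective a
    refine ⟨a • e Q 0 false ⟨n, s⟩, Submodule.smul_mem _ _
      (Finsupp.single_mem_supported _ _ (by simp [deg])), ?_⟩
    rw [map_smul, proj_single, Finsupp.smul_single, Algebra.smul_def, mul_one]
    rfl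

variable (d : ∀ n, (S (n + 1) →₀ Q ⧸ Ideal.span {f}) →ₗ[Q ⧸ Ideal.span {f}]
  (S n →₀ Q ⧸ Ideal.span {f}))

/-- `φ` defines, on the part generated by elements of degree less than `n`, a differential of
square zero lifting `d`. -/
structure IsTwist (g : Q) (φ : (Σ n, S n) → (Index S →₀ Q)) (n : ℕ) : Prop where
  mem : ∀ x, x.1 < n → φ x ∈ G' Q S x.1
  lift : ∀ m s, m + 1 < n → proj f m (φ ⟨m + 1, s⟩) = d m (Finsupp.single s 1)
  cycle : ∀ x, x.1 < n → D f g φ (φ x) = 0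

variable {d} {φ : (Σ n, S n) → (Index S →₀ Q)} {n : ℕ}

theorem IsTwist.D_mem (h : IsTwist d g φ n) {m : ℕ} {w : Index S →₀ Q} (hm : w ∈ G Q S m)
    (hn : w ∈ W Q S n) : D f g φ w ∈ G' Q S m := by
  have hw : w ∈ Finsupp.supported Q Q {j | deg j = m ∧ j.2.2.1 < n} := fun j hj => ⟨hm hj, hn hj⟩
  refine Finsupp.map_mem_of_mem_supported _ _ ?_ hw
  rintro ⟨i, ε, x⟩ ⟨rfl, hx⟩
  cases ε
  · rw [D_false]
    refine add_mem ?_ ?_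
    · rcases i with _ | i
      · simp
      · refine Submodule.smul_mem _ _ (Finsupp.single_mem_supported _ _ ?_)
        simp only [deg, Set.mem_ofPred_eq, Bool.toNat_false, Bool.toNat_true]
        omega
    · convert mulZ_pow_mem_G' (h.mem x hx) i using 1
      simp only [deg, Bool.toNat_false]
      congr 1
      omega
  · rw [D_true]
    refine sub_mem ?_ ?_
    · refine Submodule.smul_mem _ _ (Finsupp.single_mem_supported _ _ ?_)
      simp only [deg, Set.mem_ofPred_eq, Bool.toNat_false, Bool.toNat_true]
      omega
    · convert mulZ_pow_mem_G' (mulY_mem_G' (h.mem x hx)) i using 1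
      simp only [deg, Bool.toNat_true]
      congr 1
      omega

theorem IsTwist.proj_D (h : IsTwist d g φ n) {m : ℕ} {w : Index S →₀ Q} (hm : w ∈ G Q S (m + 1))
    (hn : w ∈ W Q S n) : proj f m (D f g φ w) = d m (proj f (m + 1) w) := by
  have hw : w ∈ Finsupp.supported Q Q {j | deg j = m + 1 ∧ j.2.2.1 < n} :=
    fun j hj => ⟨hm hj, hn hj⟩
  refine Finsupp.map_eq_of_mem_supported (proj f m ∘ₗ D f g φ)
    ((d m).restrictScalars Q ∘ₗ proj f (m + 1)) ?_ hw
  rintro ⟨i, ε, x⟩ ⟨hm, hx⟩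
  simp only [LinearMap.comp_apply, LinearMap.restrictScalars_apply]
  rcases i with _ | i
  · cases ε
    · obtain ⟨k, s⟩ := x
      obtain rfl : k = m + 1 := by simpa [deg] using hm
      rw [D_false_zero, h.lift m s hx, proj_single]
    · rw [D_true, map_sub, proj_smul_self, mulZ_pow_mulY, proj_mulY,
        proj_single_of_ne _ _ (by simp), map_zero, sub_zero]
  · rw [proj_single_of_ne (m + 1) _ (by simp), map_zero]
    cases ε
    · rw [D_false, mulZ_pow_succ, map_add, proj_mulZ, map_smul,
        proj_single_of_ne _ _ (by simp), smul_zero, add_zero]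
    · rw [D_true, mulZ_pow_succ, map_sub, proj_mulZ, map_smul,
        proj_single_of_ne _ _ (by simp), smul_zero, sub_zero]

theorem IsTwist.D_D (h : IsTwist d g φ n) (hfg : f * g = 0) {w : Index S →₀ Q}
    (hn : w ∈ W Q S n) : D f g φ (D f g φ w) = 0 := by
  refine Finsupp.map_eq_of_mem_supported (D f g φ ∘ₗ D f g φ) 0 ?_ hn
  rintro ⟨i, ε, x⟩ hx
  exact D_D_single _ hfg (h.cycle x hx) i ε

theorem IsTwist.mem_W (h : IsTwist d g φ n) {x : Σ n, S n} (hx : x.1 < n) : φ x ∈ W Q S x.1 :=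
  G'_le_W _ (h.mem x hx)

theorem IsTwist.D_true_sub_mem (h : IsTwist d g φ n) {x : Σ n, S n} (hx : x.1 < n) (i : ℕ) :
    D f g φ (e Q i true x) - f • e Q i false x ∈ W Q S x.1 := by
  rw [D_true, sub_sub_cancel_left]
  exact neg_mem (mulZ_pow_mem_W (mulY_mem_W (h.mem_W hx)) i)

theorem IsTwist.D_false_sub_mem (h : IsTwist d g φ n) {x : Σ n, S n} (hx : x.1 < n) (i : ℕ) :
    D f g φ (e Q i false x) - ((i : Q) * g) • e Q (i - 1) true x ∈ W Q S x.1 := by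
  rw [D_false, add_sub_cancel_left]
  exact mulZ_pow_mem_W (h.mem_W hx) i

theorem W_apply {p : ℕ} {w : Index S →₀ Q} (hw : w ∈ W Q S p) {j : Index S} (hj : p ≤ j.2.2.1) :
    w j = 0 := by
  by_contra hne
  have h : j.2.2.1 < p := hw (Finsupp.mem_support_iff.2 hne)
  omega

theorem IsTwist.D_apply_false (h : IsTwist d g φ n) {p : ℕ} (hp : p < n) {w : Index S →₀ Q}
    (hw : w ∈ W Q S (p + 1)) {x : Σ n, S n} (hx : x.1 = p) (i : ℕ) :
    D f g φ w (i, false, x) = f * w (i, true, x) := by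
  classical
  refine Finsupp.map_eq_of_mem_supported (Finsupp.lapply (i, false, x) ∘ₗ D f g φ)
    (f • Finsupp.lapply (i, true, x)) ?_ hw
  rintro ⟨i', ε, x'⟩ hx'
  have hx' : x'.1 < p + 1 := hx'
  simp only [LinearMap.comp_apply, LinearMap.smul_apply, Finsupp.lapply_apply, smul_eq_mul]
  cases ε
  · have := W_apply (h.D_false_sub_mem (x := x') (by omega) i') (j := (i, false, x))
      (by change x'.1 ≤ x.1; omega)
    rw [Finsupp.sub_apply, sub_eq_zero] at this
    rw [this]
    simp
  · have := W_apply (h.D_true_sub_mem (x := x') (by omega) i') (j := (i, false, x))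
      (by change x'.1 ≤ x.1; omega)
    rw [Finsupp.sub_apply, sub_eq_zero] at this
    rw [this, Finsupp.smul_apply, smul_eq_mul, Finsupp.single_apply, Finsupp.single_apply]
    simp

theorem IsTwist.D_apply_true (h : IsTwist d g φ n) {p : ℕ} (hp : p < n) {w : Index S →₀ Q}
    (hw : w ∈ W Q S (p + 1)) {x : Σ n, S n} (hx : x.1 = p) (i : ℕ) :
    D f g φ w (i, true, x) = ((i + 1 : ℕ) : Q) * g * w (i + 1, false, x) := by
  classical
  refine Finsupp.map_eq_of_mem_supported (Finsupp.lapply (i, true, x) ∘ₗ D f g φ)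
    ((((i + 1 : ℕ) : Q) * g) • Finsupp.lapply (i + 1, false, x)) ?_ hw
  rintro ⟨i', ε, x'⟩ hx'
  have hx' : x'.1 < p + 1 := hx'
  simp only [LinearMap.comp_apply, LinearMap.smul_apply, Finsupp.lapply_apply, smul_eq_mul]
  cases ε
  · have := W_apply (h.D_false_sub_mem (x := x') (by omega) i') (j := (i, true, x))
      (by change x'.1 ≤ x.1; omega)
    rw [Finsupp.sub_apply, sub_eq_zero] at this
    rw [this, Finsupp.smul_apply, smul_eq_mul, Finsupp.single_apply, Finsupp.single_apply]
    rcases i' with _ | i'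
    · simp
    · by_cases hi : i' = i
      · subst hi; simp
      · simp [hi]
  · have := W_apply (h.D_true_sub_mem (x := x') (by omega) i') (j := (i, true, x))
      (by change x'.1 ≤ x.1; omega)
    rw [Finsupp.sub_apply, sub_eq_zero] at this
    rw [this]
    simp

theorem IsTwist.exists_top (h : IsTwist d g φ n) (hfg : IsExactPair f g)
    (hunit : ∀ i : ℕ, IsUnit ((i + 1 : ℕ) : Q)) {p m : ℕ} (hp : p < n) {w : Index S →₀ Q}
    (hm : w ∈ G Q S m) (hw : w ∈ W Q S (p + 1)) (hD : D f g φ w = 0) (hproj : proj f m w = 0)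
    {j : Index S} (hj : w j ≠ 0) :
    ∃ v ∈ G Q S (m + 1) ⊓ W Q S (p + 1), proj f (m + 1) v = 0 ∧
      Finsupp.single j (w j) - D f g φ v ∈ W Q S p := by
  have hjm : deg j = m := hm (Finsupp.mem_support_iff.2 hj)
  have hjp : j.2.2.1 < p + 1 := hw (Finsupp.mem_support_iff.2 hj)
  rcases Nat.lt_or_ge j.2.2.1 p with hlt | hge
  · exact ⟨0, zero_mem _, map_zero _, by
      rw [map_zero, sub_zero]; exact Finsupp.single_mem_supported _ _ hlt⟩
  obtain ⟨i, ε, x⟩ := j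
  obtain hx : x.1 = p := by change x.1 < p + 1 at hjp; change p ≤ x.1 at hge; omega
  cases ε
  · have hdvd : f ∣ w (i, false, x) := by
      rw [← Ideal.mem_span_singleton]
      rcases i with _ | i
      · obtain ⟨k, s⟩ := x
        obtain rfl : k = m := by simpa [deg] using hjm
        rw [← Ideal.Quotient.eq_zero_iff_mem, ← proj_apply, hproj, Finsupp.zero_apply]
      · rw [← hfg.ann_right]
        have := h.D_apply_true hp hw hx i
        rw [hD, Finsupp.zero_apply, mul_assoc, eq_comm, (hunit i).mul_right_eq_zero] at this
        rw [mul_comm, this]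
    obtain ⟨c, hc⟩ := hdvd
    refine ⟨c • e Q i true x, ⟨?_, ?_⟩, ?_, ?_⟩
    · refine Submodule.smul_mem _ _ (Finsupp.single_mem_supported _ _ ?_)
      simp only [deg, Set.mem_ofPred_eq, Bool.toNat_false, Bool.toNat_true] at hjm ⊢
      omega
    · exact Submodule.smul_mem _ _ (Finsupp.single_mem_supported _ _ hjp)
    · rw [map_smul, proj_single_of_ne _ _ (by simp), smul_zero]
    · have := Submodule.smul_mem _ (-c) (h.D_true_sub_mem (x := x) (by omega) i)
      rw [hx] at this
      convert this using 1
      rw [hc, map_smul, smul_sub, ← Finsupp.smul_single_one]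
      module
  · have hdvd : g ∣ w (i, true, x) := by
      rw [← Ideal.mem_span_singleton, ← hfg.ann_left]
      have := h.D_apply_false hp hw hx i
      rw [hD, Finsupp.zero_apply] at this
      rw [mul_comm, ← this]
    obtain ⟨c, hc⟩ := hdvd
    obtain ⟨u, hu⟩ := hunit i
    refine ⟨(c * ↑u⁻¹) • e Q (i + 1) false x, ⟨?_, ?_⟩, ?_, ?_⟩
    · refine Submodule.smul_mem _ _ (Finsupp.single_mem_supported _ _ ?_)
      simp only [deg, Set.mem_ofPred_eq, Bool.toNat_false, Bool.toNat_true] at hjm ⊢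
      omega
    · exact Submodule.smul_mem _ _ (Finsupp.single_mem_supported _ _ hjp)
    · rw [map_smul, proj_single_of_ne _ _ (by simp), smul_zero]
    · have := Submodule.smul_mem _ (-(c * ↑u⁻¹)) (h.D_false_sub_mem (x := x) (by omega) (i + 1))
      rw [hx] at this
      convert this using 1
      have hcu : g * c = c * ↑u⁻¹ * (((i + 1 : ℕ) : Q) * g) := by
        rw [← hu]
        linear_combination (-(c * g)) * u.inv_mul
      rw [hc, map_smul, hcu, smul_sub, ← Finsupp.smul_single_one, Nat.add_sub_cancel]
      module

theorem IsTwist.exists_preimage (h : IsTwist d g φ n) (hfg : IsExactPair f g)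
    (hunit : ∀ i : ℕ, IsUnit ((i + 1 : ℕ) : Q)) {p m : ℕ} (hp : p ≤ n) {w : Index S →₀ Q}
    (hm : w ∈ G Q S m) (hw : w ∈ W Q S p) (hD : D f g φ w = 0) (hproj : proj f m w = 0) :
    ∃ v ∈ G Q S (m + 1) ⊓ W Q S p, proj f (m + 1) v = 0 ∧ D f g φ v = w := by
  have hfg0 : f * g = 0 := (hfg.ann_right f).2 (Ideal.mem_span_singleton_self f)
  induction p generalizing w with
  | zero =>
    have : w = 0 := by
      ext j
      exact W_apply hw (Nat.zero_le _)
    exact ⟨0, zero_mem _, map_zero _, by rw [map_zero, this]⟩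
  | succ p ih =>
    have key (j : Index S) : ∃ v ∈ G Q S (m + 1) ⊓ W Q S (p + 1), proj f (m + 1) v = 0 ∧
        Finsupp.single j (w j) - D f g φ v ∈ W Q S p := by
      by_cases hj : w j = 0
      · exact ⟨0, zero_mem _, map_zero _, by simp [hj]⟩
      · exact h.exists_top hfg hunit hp hm hw hD hproj hj
    choose v hv hv0 hvW using key
    let v₀ := ∑ j ∈ w.support, v j
    have hv₀ : v₀ ∈ G Q S (m + 1) ⊓ W Q S (p + 1) := sum_mem fun j _ => hv j
    have hpv₀ : proj f (m + 1) v₀ = 0 := by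
      rw [map_sum]
      exact Finset.sum_eq_zero fun j _ => hv0 j
    have hsub : w - D f g φ v₀ ∈ W Q S p := by
      have hw' : w = ∑ j ∈ w.support, Finsupp.single j (w j) := (Finsupp.sum_single w).symm
      have : w - D f g φ v₀ = ∑ j ∈ w.support, (Finsupp.single j (w j) - D f g φ (v j)) := by
        rw [Finset.sum_sub_distrib, ← hw', map_sum]
      rw [this]
      exact sum_mem fun j _ => hvW j
    have hn : v₀ ∈ W Q S n := W_mono hp hv₀.2
    obtain ⟨v₁, hv₁, hpv₁, hDv₁⟩ := ih (by omega) (w := w - D f g φ v₀)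
      (sub_mem hm (by rw [← G'_succ]; exact h.D_mem hv₀.1 hn)) hsub
      (by rw [map_sub, hD, h.D_D hfg0 hn, sub_zero])
      (by rw [map_sub, hproj, h.proj_D hv₀.1 hn, hpv₀, map_zero, sub_zero])
    refine ⟨v₀ + v₁, add_mem hv₀ ⟨hv₁.1, W_mono (Nat.le_succ p) hv₁.2⟩, ?_, ?_⟩
    · rw [map_add, hpv₀, hpv₁, add_zero]
    · rw [map_add, hDv₁, add_sub_cancel]

theorem IsTwist.exists_cycle (h : IsTwist d g φ n) (hfg : IsExactPair f g)
    (hunit : ∀ i : ℕ, IsUnit ((i + 1 : ℕ) : Q)) (hd : ∀ n v, d n (d (n + 1) v) = 0)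
    (x : Σ n, S n) (hx : x.1 = n) :
    ∃ w ∈ G' Q S n, (∀ m s, x = ⟨m + 1, s⟩ → proj f m w = d m (Finsupp.single s 1)) ∧
      D f g φ w = 0 := by
  have hfg0 : f * g = 0 := (hfg.ann_right f).2 (Ideal.mem_span_singleton_self f)
  obtain ⟨k, s⟩ := x
  obtain rfl : k = n := hx
  rcases k with _ | _ | m
  · exact ⟨0, zero_mem _, by simp, map_zero _⟩
  · obtain ⟨w, hw, hpw⟩ := exists_lift 0 (d 0 (Finsupp.single s 1))
    refine ⟨w, by rwa [G'_succ], ?_, ?_⟩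
    · rintro m t hmt
      obtain ⟨hm, ht⟩ := Sigma.mk.inj_iff.1 hmt
      obtain rfl : 0 = m := by omega
      obtain rfl := eq_of_heq ht
      exact hpw
    · have := h.D_mem hw (G_le_W (Nat.succ_pos 0) hw)
      rwa [G'_zero, Submodule.mem_bot] at this
  · obtain ⟨w, hw, hpw⟩ := exists_lift (m + 1) (d (m + 1) (Finsupp.single s 1))
    have hwW : w ∈ W Q S (m + 2) := G_le_W (Nat.lt_succ_self _) hw
    have hDw : D f g φ w ∈ G Q S m := by
      rw [← G'_succ]
      exact h.D_mem hw hwW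
    obtain ⟨v, hv, hpv, hDv⟩ := h.exists_preimage hfg hunit le_rfl hDw
      (G_le_W (by omega) hDw) (h.D_D hfg0 hwW) (by rw [h.proj_D hw hwW, hpw, hd])
    refine ⟨w - v, by rw [G'_succ]; exact sub_mem hw hv.1, ?_, ?_⟩
    · rintro m' t hmt
      obtain ⟨hm, ht⟩ := Sigma.mk.inj_iff.1 hmt
      obtain rfl : m + 1 = m' := by omega
      obtain rfl := eq_of_heq ht
      rw [map_sub, hpw, hpv, sub_zero]
    · rw [map_sub, hDv, sub_self]

theorem IsTwist.exists_succ (h : IsTwist d g φ n) (hfg : IsExactPair f g)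
    (hunit : ∀ i : ℕ, IsUnit ((i + 1 : ℕ) : Q)) (hd : ∀ n v, d n (d (n + 1) v) = 0) :
    ∃ φ' : (Σ n, S n) → (Index S →₀ Q), IsTwist d g φ' (n + 1) ∧ ∀ x, x.1 < n → φ' x = φ x := by
  classical
  choose w hw hwp hwD using h.exists_cycle hfg hunit hd
  let φ' : (Σ n, S n) → (Index S →₀ Q) := fun x => if hx : x.1 = n then w x hx else φ x
  have hlt (x : Σ n, S n) (hx : x.1 < n) : φ' x = φ x := dif_neg hx.ne
  have heq (x : Σ n, S n) (hx : x.1 = n) : φ' x = w x hx := dif_pos hx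
  have hmem (x : Σ n, S n) (hx : x.1 < n + 1) : φ' x ∈ G' Q S x.1 := by
    rcases Nat.lt_succ_iff_lt_or_eq.1 hx with hx | hx
    · rw [hlt x hx]; exact h.mem x hx
    · rw [heq x hx]; convert hw x hx
  refine ⟨φ', ⟨hmem, ?_, ?_⟩, hlt⟩
  · intro m s hm
    rcases Nat.lt_succ_iff_lt_or_eq.1 hm with hm | hm
    · rw [hlt _ hm]; exact h.lift m s hm
    · rw [heq ⟨m + 1, s⟩ hm]; exact hwp _ hm m s rfl
  · intro x hx
    rw [D_congr (n := n) hlt (W_mono (by omega) (G'_le_W _ (hmem x hx)))]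
    rcases Nat.lt_succ_iff_lt_or_eq.1 hx with hx | hx
    · rw [hlt x hx]; exact h.cycle x hx
    · rw [heq x hx]; exact hwD x hx

theorem exists_isTwist (hfg : IsExactPair f g) (hunit : ∀ i : ℕ, IsUnit ((i + 1 : ℕ) : Q))
    (hd : ∀ n v, d n (d (n + 1) v) = 0) :
    ∃ φ : (Σ n, S n) → (Index S →₀ Q), ∀ n, IsTwist d g φ n := by
  choose! F hF hFeq using
    fun (n : ℕ) (φ : (Σ n, S n) → (Index S →₀ Q)) (h : IsTwist d g φ n) =>
      h.exists_succ hfg hunit hd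
  let Φ : ℕ → (Σ n, S n) → (Index S →₀ Q) := fun n => Nat.rec 0 F n
  have hΦ (n : ℕ) : IsTwist d g (Φ n) n := by
    induction n with
    | zero => exact ⟨by simp, by simp, by simp⟩
    | succ n ih => exact hF n _ ih
  have hstep (n k : ℕ) (x : Σ n, S n) (hx : x.1 < n) : Φ (n + k) x = Φ n x := by
    induction k with
    | zero => rfl
    | succ k ih => rw [← ih]; exact hFeq _ _ (hΦ (n + k)) x (by omega)
  let φ : (Σ n, S n) → (Index S →₀ Q) := fun x => Φ (x.1 + 1) x
  have hφ (n : ℕ) (x : Σ n, S n) (hx : x.1 < n) : φ x = Φ n x := by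
    obtain ⟨k, rfl⟩ := Nat.exists_eq_add_of_le (Nat.succ_le_of_lt hx)
    exact (hstep (x.1 + 1) k x (Nat.lt_succ_self _)).symm
  refine ⟨φ, fun n => ⟨fun x hx => ?_, fun m s hm => ?_, fun x hx => ?_⟩⟩
  · rw [hφ n x hx]; exact (hΦ n).mem x hx
  · rw [hφ n _ hm]; exact (hΦ n).lift m s hm
  · rw [hφ n x hx, D_congr (hφ n) (W_mono hx.le ((hΦ n).mem_W hx))]
    exact (hΦ n).cycle x hx

end Tate

theorem CategoryTheory.ShortComplex.Exact.length_le {A : Type u} [CommRing A]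
    {S : ShortComplex (ModuleCat.{u} A)} (hS : S.Exact) :
    Module.length A S.X₂ ≤ Module.length A S.X₁ + Module.length A S.X₃ := by
  have hex := (ShortComplex.ShortExact.moduleCat_exact_iff_function_exact S).1 hS
  rw [Module.length_eq_add_of_exact (LinearMap.ker S.g.hom).subtype S.g.hom.rangeRestrict
    (Submodule.subtype_injective _) S.g.hom.surjective_rangeRestrict
    (by rw [LinearMap.exact_iff, LinearMap.ker_rangeRestrict, Submodule.range_subtype])]
  gcongr
  · rw [hex.linearMap_ker_eq]
    exact Module.length_le_of_surjective S.f.hom.rangeRestrict S.f.hom.surjective_rangeRestrict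
  · exact Module.length_le_of_injective (LinearMap.range S.g.hom).subtype
      (Submodule.subtype_injective _)

theorem homologyLength_neg {A X Y Z : Type*} [CommRing A] [AddCommGroup X] [AddCommGroup Y]
    [AddCommGroup Z] [Module A X] [Module A Y] [Module A Z] (a : X →ₗ[A] Y) (b : Y →ₗ[A] Z) :
    homologyLength (-a) (-b) = homologyLength a b := by
  unfold homologyLength
  rw [LinearMap.range_neg, LinearMap.ker_neg]

/-- The length of homology is invariant under isomorphisms that are linear over a ring mapping onto
the ring of scalars. -/
theorem homologyLength_congr {A B X Y Z X' Y' Z' : Type*} [CommRing A] [CommRing B] [Algebra A B]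
    [AddCommGroup X] [AddCommGroup Y] [AddCommGroup Z] [Module A X] [Module A Y] [Module A Z]
    [AddCommGroup X'] [AddCommGroup Y'] [AddCommGroup Z'] [Module B X'] [Module B Y'] [Module B Z']
    [Module A Y'] [IsScalarTower A B Y']
    (hAB : Function.Surjective (algebraMap A B))
    {a : X →ₗ[A] Y} {b : Y →ₗ[A] Z} {a' : X' →ₗ[B] Y'} {b' : Y' →ₗ[B] Z'}
    (eX : X ≃+ X') (eY : Y ≃ₗ[A] Y') (eZ : Z ≃+ Z')
    (ha : ∀ x, eY (a x) = a' (eX x)) (hb : ∀ y, eZ (b y) = b' (eY y)) :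
    homologyLength a b = homologyLength a' b' := by
  unfold homologyLength
  rw [← Module.length_eq_of_surjective (R := B) (S := A) hAB]
  have hmem (y : Y) : y ∈ LinearMap.ker b ↔ eY y ∈ LinearMap.ker b' := by
    rw [LinearMap.mem_ker, LinearMap.mem_ker, ← hb, eZ.map_eq_zero_iff]
  let φ : LinearMap.ker b →ₗ[A]
      (LinearMap.ker b' ⧸ (LinearMap.range a').submoduleOf (LinearMap.ker b')) :=
    ((LinearMap.range a').submoduleOf (LinearMap.ker b')).mkQ.restrictScalars A ∘ₗ
      { toFun := fun y => ⟨eY y, (hmem y).1 y.2⟩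
        map_add' := fun _ _ => Subtype.ext (map_add eY _ _)
        map_smul' := fun _ _ => Subtype.ext (map_smul eY _ _) }
  have hφ : Function.Surjective φ := by
    intro y
    obtain ⟨⟨y, hy⟩, rfl⟩ := Submodule.mkQ_surjective _ y
    obtain ⟨y, rfl⟩ := eY.surjective y
    exact ⟨⟨y, (hmem y).2 hy⟩, rfl⟩
  have hker : LinearMap.ker φ = (LinearMap.range a).submoduleOf (LinearMap.ker b) := by
    ext y
    change Submodule.Quotient.mk _ = (0 : _ ⧸ _) ↔ _
    rw [Submodule.Quotient.mk_eq_zero]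
    constructor
    · rintro ⟨x, hx⟩
      obtain ⟨x, rfl⟩ := eX.surjective x
      exact ⟨x, eY.injective ((ha x).trans hx)⟩
    · rintro ⟨x, hx⟩
      exact ⟨eX x, (ha x).symm.trans (congrArg eY hx)⟩
  rw [← hker]
  exact (φ.quotKerEquivOfSurjective hφ).length_eq

/-- A family of submodules of a module with an endomorphism of square zero that lowers the index
by one. -/
structure GradedDifferential (A W : Type*) [CommRing A] [AddCommGroup W] [Module A W] where
  /-- The family of submodules. -/
  gr : ℕ → Submodule A W
  /-- The differential. -/
  diff : W →ₗ[A] W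
  diff_mem : ∀ n, ∀ w ∈ gr (n + 1), diff w ∈ gr n
  diff_zero : ∀ w ∈ gr 0, diff w = 0
  diff_diff : ∀ w, diff (diff w) = 0

namespace GradedDifferential

section

variable {A W : Type*} [CommRing A] [AddCommGroup W] [Module A W] (K : GradedDifferential A W)

/-- The differential between two consecutive submodules. -/
def d (n : ℕ) : K.gr (n + 1) →ₗ[A] K.gr n := K.diff.restrict (K.diff_mem n)

theorem coe_d (n : ℕ) (w : K.gr (n + 1)) : (K.d n w : W) = K.diff w := rfl

theorem d_comp_d (n : ℕ) : K.d n ∘ₗ K.d (n + 1) = 0 :=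
  LinearMap.ext fun w => Subtype.ext (K.diff_diff w)

/-- The length of the homology in degree `n + 1`. -/
noncomputable def length (n : ℕ) : ℕ∞ := homologyLength (K.d (n + 1)) (K.d n)

/-- The graded differential module with the indices of the submodules raised by one. -/
def shift : GradedDifferential A W where
  gr n := Nat.casesOn n ⊥ K.gr
  diff := K.diff
  diff_mem n w hw := by
    cases n with
    | zero => exact (Submodule.mem_bot A).2 (K.diff_zero w hw)
    | succ n => exact K.diff_mem n w hw
  diff_zero w hw := by rw [(Submodule.mem_bot A).1 hw, map_zero]
  diff_diff := K.diff_diff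

theorem shift_diff (w : W) : K.shift.diff w = K.diff w := rfl

/-- The graded differential module with the opposite differential. -/
def neg : GradedDifferential A W where
  gr := K.gr
  diff := -K.diff
  diff_mem n w hw := neg_mem (K.diff_mem n w hw)
  diff_zero w hw := by simp [K.diff_zero w hw]
  diff_diff w := by simp [K.diff_diff]

theorem neg_diff (w : W) : K.neg.diff w = -K.diff w := rfl

theorem length_neg (n : ℕ) : K.neg.length n = K.length n :=
  homologyLength_neg (K.d (n + 1)) (K.d n)

end

section

variable {A : Type u} [CommRing A] {W₁ W₂ W₃ : Type u} [AddCommGroup W₁] [AddCommGroup W₂]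
  [AddCommGroup W₃] [Module A W₁] [Module A W₂] [Module A W₃]

/-- The chain complex formed by the submodules of a graded differential module. -/
noncomputable def complex (K : GradedDifferential A W₁) : ChainComplex (ModuleCat.{u} A) ℕ :=
  moduleComplex (fun n => K.gr n) K.d K.d_comp_d

theorem complex_d (K : GradedDifferential A W₁) (n : ℕ) :
    K.complex.d (n + 1) n = ModuleCat.ofHom (K.d n) :=
  moduleComplex_d (fun n => K.gr n) K.d K.d_comp_d n

theorem length_homology_complex (K : GradedDifferential A W₁) (n : ℕ) :
    Module.length A (K.complex.homology (n + 1)) = K.length n :=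
  length_homology_moduleComplex _ _ _ n

/-- The chain map induced by a linear map. -/
noncomputable def map (K₁ : GradedDifferential A W₁) (K₂ : GradedDifferential A W₂)
    (α : W₁ →ₗ[A] W₂) (hα : ∀ n, ∀ w ∈ K₁.gr n, α w ∈ K₂.gr n)
    (comm : ∀ n, ∀ w ∈ K₁.gr n, α (K₁.diff w) = K₂.diff (α w)) : K₁.complex ⟶ K₂.complex where
  f n := ModuleCat.ofHom (α.restrict (hα n) : K₁.gr n →ₗ[A] K₂.gr n)
  comm' i j hij := by
    obtain rfl : j + 1 = i := hij
    rw [complex_d, complex_d]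
    refine ModuleCat.hom_ext (LinearMap.ext fun w => Subtype.ext ?_)
    exact (comm _ w.1 w.2).symm

/-- A short exact sequence of graded differential modules bounds the lengths of the homology
modules of each of them by those of the other two. -/
theorem length_le_of_shortExact (K₁ : GradedDifferential A W₁) (K₂ : GradedDifferential A W₂)
    (K₃ : GradedDifferential A W₃) (α : W₁ →ₗ[A] W₂) (β : W₂ →ₗ[A] W₃)
    (hα : ∀ n, ∀ w ∈ K₁.gr n, α w ∈ K₂.gr n) (hβ : ∀ n, ∀ w ∈ K₂.gr n, β w ∈ K₃.gr n)
    (commα : ∀ n, ∀ w ∈ K₁.gr n, α (K₁.diff w) = K₂.diff (α w))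
    (commβ : ∀ n, ∀ w ∈ K₂.gr n, β (K₂.diff w) = K₃.diff (β w))
    (inj : ∀ n, ∀ w ∈ K₁.gr n, α w = 0 → w = 0)
    (zero : ∀ n, ∀ w ∈ K₁.gr n, β (α w) = 0)
    (exact : ∀ n, ∀ w ∈ K₂.gr n, β w = 0 → ∃ v ∈ K₁.gr n, α v = w)
    (surj : ∀ n, ∀ w ∈ K₃.gr n, ∃ v ∈ K₂.gr n, β v = w) (n : ℕ) :
    K₂.length n ≤ K₁.length n + K₃.length n ∧
      K₃.length (n + 1) ≤ K₂.length (n + 1) + K₁.length n := by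
  let S : ShortComplex (ChainComplex (ModuleCat.{u} A) ℕ) :=
    { f := map K₁ K₂ α hα commα
      g := map K₂ K₃ β hβ commβ
      zero := by
        ext n w
        exact Subtype.ext (zero n w.1 w.2) }
  have hS : S.ShortExact := by
    refine HomologicalComplex.shortExact_of_degreewise_shortExact S fun i => ?_
    refine { exact := ?_, mono_f := ?_, epi_g := ?_ }
    · refine (ShortComplex.moduleCat_exact_iff _).2 fun w hw => ?_
      obtain ⟨v, hv, hvw⟩ := exact i w.1 w.2 (congrArg Subtype.val hw)
      exact ⟨⟨v, hv⟩, Subtype.ext hvw⟩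
    · refine (ModuleCat.mono_iff_injective _).2 ((injective_iff_map_eq_zero _).2 fun w hw => ?_)
      exact Subtype.ext (inj i w.1 w.2 (congrArg Subtype.val hw))
    · refine (ModuleCat.epi_iff_surjective _).2 fun w => ?_
      obtain ⟨v, hv, hvw⟩ := surj i w.1 w.2
      exact ⟨⟨v, hv⟩, Subtype.ext hvw⟩
  simp only [← length_homology_complex]
  exact ⟨(hS.homology_exact₂ (n + 1)).length_le,
    (hS.homology_exact₃ (n + 2) (n + 1) rfl).length_le⟩

end

end GradedDifferential

section CoeffMap

variable {Q ι κ μ : Type*} [CommRing Q] (N : Type*) [AddCommGroup N] [Module Q N]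

open scoped Classical in
variable (Q ι) in
/-- The tensor product of a free module with `N`, as finitely supported functions. -/
noncomputable def tensorEquiv : (ι →₀ Q) ⊗[Q] N ≃ₗ[Q] (ι →₀ N) := finsuppScalarLeft Q N ι

variable {N} in
@[simp]
theorem tensorEquiv_tmul_apply (p : ι →₀ Q) (y : N) (i : ι) :
    tensorEquiv Q ι N (p ⊗ₜ y) i = p i • y := by
  simp [tensorEquiv]

variable {N} in
@[simp]
theorem tensorEquiv_symm_single (i : ι) (y : N) :
    (tensorEquiv Q ι N).symm (Finsupp.single i y) = Finsupp.single i 1 ⊗ₜ y := by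
  simp [tensorEquiv]

/-- The map on finitely supported functions with values in `N` that has the same matrix as a given
map on finitely supported functions with values in the ring. -/
noncomputable def coeffMap (T : (ι →₀ Q) →ₗ[Q] (κ →₀ Q)) : (ι →₀ N) →ₗ[Q] (κ →₀ N) :=
  (tensorEquiv Q κ N).toLinearMap ∘ₗ T.rTensor N ∘ₗ (tensorEquiv Q ι N).symm.toLinearMap

theorem coeffMap_tensorEquiv (T : (ι →₀ Q) →ₗ[Q] (κ →₀ Q)) (t : (ι →₀ Q) ⊗[Q] N) :
    coeffMap N T (tensorEquiv Q ι N t) = tensorEquiv Q κ N (T.rTensor N t) := by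
  simp [coeffMap]

theorem coeffMap_single_apply (T : (ι →₀ Q) →ₗ[Q] (κ →₀ Q)) (j : ι) (y : N) (k : κ) :
    coeffMap N T (Finsupp.single j y) k = T (Finsupp.single j 1) k • y := by
  simp [coeffMap]

theorem coeffMap_comp (T : (κ →₀ Q) →ₗ[Q] (μ →₀ Q)) (T' : (ι →₀ Q) →ₗ[Q] (κ →₀ Q))
    (w : ι →₀ N) : coeffMap N (T ∘ₗ T') w = coeffMap N T (coeffMap N T' w) := by
  simp [coeffMap, LinearMap.rTensor_comp]

theorem coeffMap_add (T T' : (ι →₀ Q) →ₗ[Q] (κ →₀ Q)) (w : ι →₀ N) :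
    coeffMap N (T + T') w = coeffMap N T w + coeffMap N T' w := by
  simp [coeffMap, LinearMap.rTensor_add]

theorem coeffMap_smul_eq_zero {a : Q} (ha : ∀ y : N, a • y = 0) (T : (ι →₀ Q) →ₗ[Q] (κ →₀ Q))
    (w : ι →₀ N) : coeffMap N (a • T) w = 0 := by
  have : coeffMap N (a • T) w = a • coeffMap N T w := by simp [coeffMap, LinearMap.rTensor_smul]
  rw [this]
  ext k
  exact ha _

theorem coeffMap_zero (w : ι →₀ N) : coeffMap N (0 : (ι →₀ Q) →ₗ[Q] (κ →₀ Q)) w = 0 := by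
  simp [coeffMap]

theorem coeffMap_id (w : ι →₀ N) : coeffMap N (LinearMap.id : (ι →₀ Q) →ₗ[Q] _) w = w := by
  simp [coeffMap]

variable {N}

theorem Finsupp.map_mem_of_mem_supported_coeff {V : Type*} [AddCommGroup V] [Module Q V]
    {s : Set ι} (T : (ι →₀ N) →ₗ[Q] V) (P : Submodule Q V)
    (h : ∀ j ∈ s, ∀ y, T (Finsupp.single j y) ∈ P) {w : ι →₀ N}
    (hw : w ∈ Finsupp.supported N Q s) : T w ∈ P := by
  rw [← Finsupp.sum_single w, Finsupp.sum, map_sum]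
  exact sum_mem fun j hj => h j (hw hj) _

theorem coeffMap_mem {T : (ι →₀ Q) →ₗ[Q] (κ →₀ Q)} {s : Set ι} {t : Set κ}
    (h : ∀ j ∈ s, T (Finsupp.single j 1) ∈ Finsupp.supported Q Q t) {w : ι →₀ N}
    (hw : w ∈ Finsupp.supported N Q s) : coeffMap N T w ∈ Finsupp.supported N Q t := by
  refine Finsupp.map_mem_of_mem_supported_coeff _ _ (fun j hj y k hk => ?_) hw
  refine h j hj (Finsupp.mem_support_iff.2 fun h0 => ?_)
  rw [SetLike.mem_coe, Finsupp.mem_support_iff, coeffMap_single_apply, h0, zero_smul] at hk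
  exact hk rfl

theorem coeffMap_eq {T T' : (ι →₀ Q) →ₗ[Q] (κ →₀ Q)} {s : Set ι}
    (h : ∀ j ∈ s, T (Finsupp.single j 1) = T' (Finsupp.single j 1)) {w : ι →₀ N}
    (hw : w ∈ Finsupp.supported N Q s) : coeffMap N T w = coeffMap N T' w := by
  rw [← sub_eq_zero, ← LinearMap.sub_apply, ← Submodule.mem_bot Q]
  refine Finsupp.map_mem_of_mem_supported_coeff _ _ (fun j hj y => ?_) hw
  rw [Submodule.mem_bot, LinearMap.sub_apply, sub_eq_zero]
  ext k
  rw [coeffMap_single_apply, coeffMap_single_apply, h j hj]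

end CoeffMap

namespace Tate

variable {Q : Type u} [CommRing Q] {S : ℕ → Type u}

/-- Removal of one factor `z`, zero on the elements without such a factor. -/
noncomputable def divZ : (Index S →₀ Q) →ₗ[Q] (Index S →₀ Q) :=
  Finsupp.linearCombination Q fun j => if j.1 = 0 then 0 else e Q (j.1 - 1) j.2.1 j.2.2

/-- Projection onto the elements without a factor `z`. -/
noncomputable def modZ : (Index S →₀ Q) →ₗ[Q] (Index S →₀ Q) :=
  Finsupp.linearCombination Q fun j => if j.1 = 0 then e Q 0 j.2.1 j.2.2 else 0

/-- Projection onto the elements `y * x`, followed by removal of `y`. -/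
noncomputable def divY : (Index S →₀ Q) →ₗ[Q] (Index S →₀ Q) :=
  Finsupp.linearCombination Q fun j =>
    if j.1 = 0 then if j.2.1 then e Q 0 false j.2.2 else 0 else 0

/-- Projection onto the elements without factors `y` and `z`. -/
noncomputable def modYZ : (Index S →₀ Q) →ₗ[Q] (Index S →₀ Q) :=
  Finsupp.linearCombination Q fun j =>
    if j.1 = 0 then if j.2.1 then 0 else e Q 0 false j.2.2 else 0

section

variable (i : ℕ) (ε : Bool) (x : Σ n, S n)

@[simp] theorem divZ_zero : divZ (e Q 0 ε x) = 0 := by simp [divZ]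
@[simp] theorem divZ_succ : divZ (e Q (i + 1) ε x) = e Q i ε x := by simp [divZ]
@[simp] theorem modZ_zero : modZ (e Q 0 ε x) = e Q 0 ε x := by simp [modZ]
@[simp] theorem modZ_succ : modZ (e Q (i + 1) ε x) = 0 := by simp [modZ]
@[simp] theorem divY_true : divY (e Q 0 true x) = e Q 0 false x := by simp [divY]
@[simp] theorem divY_false : divY (e Q 0 false x) = 0 := by simp [divY]
@[simp] theorem divY_succ : divY (e Q (i + 1) ε x) = 0 := by simp [divY]
@[simp] theorem modYZ_true : modYZ (e Q 0 true x) = 0 := by simp [modYZ]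
@[simp] theorem modYZ_false : modYZ (e Q 0 false x) = e Q 0 false x := by simp [modYZ]
@[simp] theorem modYZ_succ : modYZ (e Q (i + 1) ε x) = 0 := by simp [modYZ]

end

theorem divZ_comp_mulZ : divZ ∘ₗ mulZ = (LinearMap.id : (Index S →₀ Q) →ₗ[Q] _) :=
  hom_ext fun i ε x => by simp

theorem mulZ_comp_divZ_add : mulZ ∘ₗ divZ + modZ = (LinearMap.id : (Index S →₀ Q) →ₗ[Q] _) :=
  hom_ext fun i ε x => by cases i <;> simp

theorem modZ_comp_mulZ : modZ ∘ₗ mulZ = (0 : (Index S →₀ Q) →ₗ[Q] _) :=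
  hom_ext fun i ε x => by simp

theorem modZ_comp_mulY : modZ ∘ₗ mulY = (mulY ∘ₗ modYZ : (Index S →₀ Q) →ₗ[Q] _) :=
  hom_ext fun i ε x => by cases i <;> cases ε <;> simp

theorem modYZ_comp_mulY : modYZ ∘ₗ mulY = (0 : (Index S →₀ Q) →ₗ[Q] _) :=
  hom_ext fun i ε x => by cases i <;> cases ε <;> simp

theorem modYZ_comp_modZ : modYZ ∘ₗ modZ = (modYZ : (Index S →₀ Q) →ₗ[Q] _) :=
  hom_ext fun i ε x => by cases i <;> simp

theorem mulY_comp_divY_add : mulY ∘ₗ divY + modYZ = (modZ : (Index S →₀ Q) →ₗ[Q] _) :=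
  hom_ext fun i ε x => by cases i <;> cases ε <;> simp

end Tate

namespace Tate

variable {Q : Type u} [CommRing Q] {S : ℕ → Type u} {f g : Q}
  {d : ∀ n, (S (n + 1) →₀ Q ⧸ Ideal.span {f}) →ₗ[Q ⧸ Ideal.span {f}]
    (S n →₀ Q ⧸ Ideal.span {f})}
  {φ : (Σ n, S n) → (Index S →₀ Q)}

theorem D_mem_G (h : ∀ n, IsTwist d g φ n) {n : ℕ} {w : Index S →₀ Q} (hw : w ∈ G Q S (n + 1)) :
    D f g φ w ∈ G Q S n := by
  rw [← G'_succ]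
  exact (h (n + 2)).D_mem hw (G_le_W (Nat.lt_succ_self _) hw)

theorem D_eq_zero (h : ∀ n, IsTwist d g φ n) {w : Index S →₀ Q} (hw : w ∈ G Q S 0) :
    D f g φ w = 0 := by
  have := (h 1).D_mem hw (G_le_W (Nat.lt_succ_self _) hw)
  rwa [G'_zero, Submodule.mem_bot] at this

theorem D_comp_D (h : ∀ n, IsTwist d g φ n) (hfg : f * g = 0) :
    D f g φ ∘ₗ D f g φ = 0 :=
  hom_ext fun i ε x => D_D_single φ hfg ((h (x.1 + 1)).cycle x (Nat.lt_succ_self _)) i ε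

/-- The set of indices of the basis elements of degree `n` without factors `y` and `z`. -/
abbrev baseIndex (S : ℕ → Type u) (n : ℕ) (s : S n) : Index S := (0, false, ⟨n, s⟩)

variable (N : Type u) [AddCommGroup N] [Module Q N]

theorem coeffMap_D_mulZ (hg : ∀ y : N, g • y = 0) (w : Index S →₀ N) :
    coeffMap N (D f g φ) (coeffMap (Q := Q) N mulZ w) =
      coeffMap (Q := Q) N mulZ (coeffMap N (D f g φ) w) := by
  rw [← coeffMap_comp, show D f g φ ∘ₗ mulZ = mulZ ∘ₗ D f g φ + g • mulY from
    LinearMap.ext (D_mulZ f g φ), coeffMap_add, coeffMap_smul_eq_zero N hg, add_zero,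
    coeffMap_comp]

theorem coeffMap_D_mulY (hf : ∀ y : N, f • y = 0) (w : Index S →₀ N) :
    coeffMap N (D f g φ) (coeffMap (Q := Q) N mulY w) =
      -coeffMap (Q := Q) N mulY (coeffMap N (D f g φ) w) := by
  rw [eq_neg_iff_add_eq_zero, ← coeffMap_comp, ← coeffMap_comp, ← coeffMap_add,
    show D f g φ ∘ₗ mulY + mulY ∘ₗ D f g φ = f • LinearMap.id from
      LinearMap.ext fun w => by simp [D_mulY], coeffMap_smul_eq_zero N hf]

theorem coeffMap_mulZ_divZ_add (w : Index S →₀ N) :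
    coeffMap (Q := Q) N mulZ (coeffMap (Q := Q) N divZ w) +
      coeffMap (Q := Q) N modZ w = w := by
  rw [← coeffMap_comp, ← coeffMap_add, mulZ_comp_divZ_add, coeffMap_id]

theorem coeffMap_modZ_D_modZ (hg : ∀ y : N, g • y = 0) (w : Index S →₀ N) :
    coeffMap (Q := Q) N modZ (coeffMap N (D f g φ) (coeffMap (Q := Q) N modZ w)) =
      coeffMap (Q := Q) N modZ (coeffMap N (D f g φ) w) := by
  conv_rhs => rw [← coeffMap_mulZ_divZ_add (Q := Q) N w]
  rw [map_add, map_add, coeffMap_D_mulZ N hg, ← coeffMap_comp N modZ mulZ, modZ_comp_mulZ,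
    coeffMap_zero, zero_add]

theorem coeffMap_modYZ_D_modYZ (hf : ∀ y : N, f • y = 0) (hg : ∀ y : N, g • y = 0)
    (w : Index S →₀ N) :
    coeffMap (Q := Q) N modYZ (coeffMap N (D f g φ) (coeffMap (Q := Q) N modYZ w)) =
      coeffMap (Q := Q) N modYZ (coeffMap N (D f g φ) w) := by
  have h (v : Index S →₀ N) : coeffMap (Q := Q) N modYZ v =
      coeffMap (Q := Q) N modYZ (coeffMap (Q := Q) N modZ v) := by
    rw [← coeffMap_comp, modYZ_comp_modZ]
  rw [h (coeffMap N (D f g φ) w), ← coeffMap_modZ_D_modZ N hg, ← h]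
  conv_rhs => rw [← mulY_comp_divY_add]
  rw [coeffMap_add, map_add, map_add, coeffMap_comp N mulY, coeffMap_D_mulY N hf, map_neg,
    ← coeffMap_comp N modYZ mulY, modYZ_comp_mulY, coeffMap_zero, neg_zero, zero_add]

theorem coeffMap_D_eq_zero (h : ∀ n, IsTwist d g φ n) {w : Index S →₀ N}
    (hw : w ∈ Finsupp.supported N Q {j | deg j = 0}) : coeffMap N (D f g φ) w = 0 := by
  rw [coeffMap_eq (T' := 0) (fun _ hj => D_eq_zero h (Finsupp.single_mem_supported _ _ hj)) hw,
    coeffMap_zero]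

theorem coeffMap_D_mem (h : ∀ n, IsTwist d g φ n) {n : ℕ} {w : Index S →₀ N}
    (hw : w ∈ Finsupp.supported N Q {j | deg j = n + 1}) :
    coeffMap N (D f g φ) w ∈ Finsupp.supported N Q {j | deg j = n} :=
  coeffMap_mem (fun _ hj => D_mem_G h (Finsupp.single_mem_supported _ _ hj)) hw

/-- The Tate resolution with coefficients in `N`. -/
noncomputable def total (h : ∀ n, IsTwist d g φ n) (hfg : f * g = 0) :
    GradedDifferential Q (Index S →₀ N) where
  gr n := Finsupp.supported N Q {j | deg j = n}
  diff := coeffMap N (D f g φ)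
  diff_mem n w hw := coeffMap_D_mem N h hw
  diff_zero w hw := coeffMap_D_eq_zero N h hw
  diff_diff w := by rw [← coeffMap_comp, D_comp_D h hfg, coeffMap_zero]

theorem modZ_mem {n : ℕ} {w : Index S →₀ N} (hw : w ∈ Finsupp.supported N Q {j | deg j = n}) :
    coeffMap (Q := Q) N modZ w ∈ Finsupp.supported N Q {j | j.1 = 0 ∧ deg j = n} := by
  refine coeffMap_mem ?_ hw
  rintro ⟨i, ε, x⟩ hj
  cases i
  · rw [modZ_zero]
    exact Finsupp.single_mem_supported _ _ ⟨rfl, hj⟩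
  · rw [modZ_succ]
    exact zero_mem _

theorem modYZ_mem {n : ℕ} {w : Index S →₀ N} (hw : w ∈ Finsupp.supported N Q {j | deg j = n}) :
    coeffMap (Q := Q) N modYZ w ∈ Finsupp.supported N Q (Set.range (baseIndex S n)) := by
  refine coeffMap_mem ?_ hw
  rintro ⟨i, ε, ⟨k, s⟩⟩ hj
  cases i
  · cases ε
    · rw [modYZ_false]
      obtain rfl : k = n := by simpa [deg] using hj
      exact Finsupp.single_mem_supported _ _ ⟨s, rfl⟩
    · rw [modYZ_true]
      exact zero_mem _
  · rw [modYZ_succ]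
    exact zero_mem _

theorem supported_base_le (n : ℕ) : Finsupp.supported N Q (Set.range (baseIndex S n)) ≤
    Finsupp.supported N Q {j | j.1 = 0 ∧ deg j = n} :=
  Finsupp.supported_mono (by rintro _ ⟨s, rfl⟩; exact ⟨rfl, by simp [deg]⟩)

theorem supported_modZ_le (n : ℕ) : Finsupp.supported N Q {j : Index S | j.1 = 0 ∧ deg j = n} ≤
    Finsupp.supported N Q {j | deg j = n} :=
  Finsupp.supported_mono fun _ hj => hj.2

theorem modZ_eq_self {n : ℕ} {w : Index S →₀ N}
    (hw : w ∈ Finsupp.supported N Q {j | j.1 = 0 ∧ deg j = n}) :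
    coeffMap (Q := Q) N modZ w = w := by
  rw [coeffMap_eq (T' := LinearMap.id) ?_ hw, coeffMap_id]
  rintro ⟨i, ε, x⟩ ⟨rfl, -⟩
  exact modZ_zero ε x

theorem modYZ_eq_self {n : ℕ} {w : Index S →₀ N}
    (hw : w ∈ Finsupp.supported N Q (Set.range (baseIndex S n))) :
    coeffMap (Q := Q) N modYZ w = w := by
  rw [coeffMap_eq (T' := LinearMap.id) ?_ hw, coeffMap_id]
  rintro _ ⟨s, rfl⟩
  exact modYZ_false _

theorem total_diff (h : ∀ n, IsTwist d g φ n) (hfg : f * g = 0) (w : Index S →₀ N) :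
    (total N h hfg).diff w = coeffMap N (D f g φ) w := rfl

/-- The quotient of the Tate resolution with coefficients in `N` by the multiples of `z`. -/
noncomputable def quotZ (h : ∀ n, IsTwist d g φ n) (hfg : f * g = 0)
    (hg : ∀ y : N, g • y = 0) : GradedDifferential Q (Index S →₀ N) where
  gr n := Finsupp.supported N Q {j | j.1 = 0 ∧ deg j = n}
  diff := coeffMap N modZ ∘ₗ coeffMap N (D f g φ)
  diff_mem n w hw := modZ_mem N (coeffMap_D_mem N h (supported_modZ_le N _ hw))
  diff_zero w hw := by
    rw [LinearMap.comp_apply, coeffMap_D_eq_zero N h (supported_modZ_le N _ hw), map_zero]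
  diff_diff w := by
    simp only [LinearMap.comp_apply]
    rw [coeffMap_modZ_D_modZ N hg, ← coeffMap_comp N (D f g φ), D_comp_D h hfg, coeffMap_zero,
      map_zero]

theorem quotZ_diff (h : ∀ n, IsTwist d g φ n) (hfg : f * g = 0) (hg : ∀ y : N, g • y = 0)
    (w : Index S →₀ N) :
    (quotZ N h hfg hg).diff w = coeffMap (Q := Q) N modZ (coeffMap N (D f g φ) w) := rfl

/-- The quotient of the Tate resolution with coefficients in `N` by the multiples of `y` and `z`. -/
noncomputable def quotYZ (h : ∀ n, IsTwist d g φ n) (hfg : f * g = 0) (hf : ∀ y : N, f • y = 0)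
    (hg : ∀ y : N, g • y = 0) : GradedDifferential Q (Index S →₀ N) where
  gr n := Finsupp.supported N Q (Set.range (baseIndex S n))
  diff := coeffMap N modYZ ∘ₗ coeffMap N (D f g φ)
  diff_mem n w hw := modYZ_mem N (coeffMap_D_mem N h
    (supported_modZ_le N _ (supported_base_le N _ hw)))
  diff_zero w hw := by
    rw [LinearMap.comp_apply,
      coeffMap_D_eq_zero N h (supported_modZ_le N _ (supported_base_le N _ hw)), map_zero]
  diff_diff w := by
    simp only [LinearMap.comp_apply]
    rw [coeffMap_modYZ_D_modYZ N hf hg, ← coeffMap_comp N (D f g φ), D_comp_D h hfg, coeffMap_zero,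
      map_zero]

theorem quotYZ_diff (h : ∀ n, IsTwist d g φ n) (hfg : f * g = 0) (hf : ∀ y : N, f • y = 0)
    (hg : ∀ y : N, g • y = 0) (w : Index S →₀ N) :
    (quotYZ N h hfg hf hg).diff w = coeffMap (Q := Q) N modYZ (coeffMap N (D f g φ) w) := rfl

theorem length_quotZ (h : ∀ n, IsTwist d g φ n) (hfg : f * g = 0) (hg : ∀ y : N, g • y = 0)
    (n : ℕ) :
    (total N h hfg).length (n + 2) ≤ (total N h hfg).length n + (quotZ N h hfg hg).length (n + 2) ∧
    (quotZ N h hfg hg).length (n + 3) ≤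
      (total N h hfg).length (n + 3) + (total N h hfg).length n := by
  refine GradedDifferential.length_le_of_shortExact (total N h hfg).shift.shift (total N h hfg)
    (quotZ N h hfg hg) (coeffMap N mulZ) (coeffMap N modZ) ?_ (fun n w => modZ_mem N)
    (fun n w _ => ?_) (fun n w _ => ?_) (fun n w _ h0 => ?_)
    (fun n w _ => ?_) ?_ (fun n w hw => ⟨w, supported_modZ_le N _ hw, modZ_eq_self N hw⟩) (n + 2)
  · intro n w hw
    rcases n with _ | _ | n
    · rw [(Submodule.mem_bot Q).1 hw, map_zero]; exact zero_mem _
    · rw [(Submodule.mem_bot Q).1 hw, map_zero]; exact zero_mem _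
    · refine coeffMap_mem (s := {j | deg j = n}) (t := {j | deg j = n + 2}) ?_ hw
      rintro ⟨i, ε, x⟩ hj
      rw [mulZ_single]
      refine Finsupp.single_mem_supported _ _ ?_
      simp only [deg, Set.mem_ofPred_eq] at hj ⊢
      omega
  · rw [GradedDifferential.shift_diff, GradedDifferential.shift_diff, total_diff, total_diff,
      coeffMap_D_mulZ N hg]
  · rw [total_diff, quotZ_diff, coeffMap_modZ_D_modZ N hg]
  · rw [← coeffMap_id (Q := Q) N w, ← divZ_comp_mulZ, coeffMap_comp, h0, map_zero]
  · rw [← coeffMap_comp, modZ_comp_mulZ, coeffMap_zero]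
  · intro n w hw h0
    refine ⟨coeffMap (Q := Q) N divZ w, ?_, ?_⟩
    · rcases n with _ | _ | n
      · refine (Submodule.mem_bot Q).2 ?_
        rw [coeffMap_eq (s := {j | deg j = 0}) (T' := 0) ?_ hw, coeffMap_zero]
        rintro ⟨i, ε, x⟩ hj
        obtain rfl : i = 0 := by simp only [deg, Set.mem_ofPred_eq] at hj; omega
        exact divZ_zero ε x
      · refine (Submodule.mem_bot Q).2 ?_
        rw [coeffMap_eq (s := {j | deg j = 1}) (T' := 0) ?_ hw, coeffMap_zero]
        rintro ⟨i, ε, x⟩ hj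
        obtain rfl : i = 0 := by simp only [deg, Set.mem_ofPred_eq] at hj; omega
        exact divZ_zero ε x
      · refine coeffMap_mem (s := {j | deg j = n + 2}) (t := {j | deg j = n}) ?_ hw
        rintro ⟨i, ε, x⟩ hj
        cases i
        · rw [divZ_zero]
          exact zero_mem _
        · rw [divZ_succ]
          refine Finsupp.single_mem_supported _ _ ?_
          simp only [deg, Set.mem_ofPred_eq] at hj ⊢
          omega
    · have := coeffMap_mulZ_divZ_add (Q := Q) N w
      rwa [h0, add_zero] at this

theorem length_quotYZ (h : ∀ n, IsTwist d g φ n) (hfg : f * g = 0) (hf : ∀ y : N, f • y = 0)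
    (hg : ∀ y : N, g • y = 0) (n : ℕ) :
    (quotZ N h hfg hg).length (n + 1) ≤
      (quotYZ N h hfg hf hg).length n + (quotYZ N h hfg hf hg).length (n + 1) ∧
    (quotYZ N h hfg hf hg).length (n + 2) ≤
      (quotZ N h hfg hg).length (n + 2) + (quotYZ N h hfg hf hg).length n := by
  have hlen : (quotYZ N h hfg hf hg).shift.neg.length (n + 1) = (quotYZ N h hfg hf hg).length n :=
    (quotYZ N h hfg hf hg).shift.length_neg (n + 1)
  have hdiv (v : Index S →₀ N) (n : ℕ)
      (hv : v ∈ Finsupp.supported N Q {j : Index S | j.1 = 0 ∧ deg j = n}) :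
      coeffMap (Q := Q) N mulY (coeffMap (Q := Q) N divY v) +
        coeffMap (Q := Q) N modYZ v = v := by
    rw [← coeffMap_comp, ← coeffMap_add, mulY_comp_divY_add, modZ_eq_self N hv]
  have := GradedDifferential.length_le_of_shortExact (quotYZ N h hfg hf hg).shift.neg
    (quotZ N h hfg hg) (quotYZ N h hfg hf hg) (coeffMap N mulY) (coeffMap N modYZ) ?_
    (fun n w hw => modYZ_mem N (supported_modZ_le N _ hw)) (fun n w _ => ?_) (fun n w hw => ?_)
    ?_ (fun n w _ => ?_) ?_
    (fun n w hw => ⟨w, supported_base_le N _ hw, modYZ_eq_self N hw⟩) (n + 1)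
  · rwa [hlen] at this
  · intro n w hw
    rcases n with _ | n
    · rw [(Submodule.mem_bot Q).1 hw, map_zero]; exact zero_mem _
    · refine coeffMap_mem (s := Set.range (baseIndex S n))
        (t := {j : Index S | j.1 = 0 ∧ deg j = n + 1})
        ?_ hw
      rintro _ ⟨s, rfl⟩
      rw [mulY_single_false]
      exact Finsupp.single_mem_supported _ _ ⟨rfl, by simp [deg, add_comm]⟩
  · rw [GradedDifferential.neg_diff, GradedDifferential.shift_diff, quotYZ_diff, quotZ_diff]
    rw [coeffMap_D_mulY N hf, map_neg, map_neg, ← coeffMap_comp N mulY modYZ,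
      ← coeffMap_comp N modZ mulY, modZ_comp_mulY]
  · rw [quotYZ_diff, quotZ_diff]
    rw [← coeffMap_comp, modYZ_comp_modZ, coeffMap_modYZ_D_modYZ N hf hg]
  · intro n w hw h0
    rcases n with _ | n
    · exact (Submodule.mem_bot Q).1 hw
    · have : coeffMap (Q := Q) N (divY ∘ₗ mulY) w = w := by
        rw [coeffMap_eq (T' := LinearMap.id) (s := Set.range (baseIndex S n)) ?_ hw, coeffMap_id]
        rintro _ ⟨s, rfl⟩
        simp
      rw [← this, coeffMap_comp, h0, map_zero]
  · rw [← coeffMap_comp, modYZ_comp_mulY, coeffMap_zero]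
  · intro n w hw h0
    refine ⟨coeffMap (Q := Q) N divY w, ?_, ?_⟩
    · rcases n with _ | n
      · refine (Submodule.mem_bot Q).2 ?_
        rw [coeffMap_eq (s := {j : Index S | j.1 = 0 ∧ deg j = 0}) (T' := 0) ?_ hw, coeffMap_zero]
        rintro ⟨i, ε, x⟩ ⟨hi, hj⟩
        obtain rfl : i = 0 := hi
        cases ε
        · exact divY_false x
        · simp [deg] at hj
      · refine coeffMap_mem (s := {j : Index S | j.1 = 0 ∧ deg j = n + 1})
          (t := Set.range (baseIndex S n)) ?_ hw
        rintro ⟨i, ε, ⟨k, s⟩⟩ ⟨hi, hj⟩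
        obtain rfl : i = 0 := hi
        cases ε
        · rw [divY_false]
          exact zero_mem _
        · rw [divY_true]
          obtain rfl : k = n := by simp [deg] at hj; omega
          exact Finsupp.single_mem_supported _ _ ⟨s, rfl⟩
    · have := hdiv w n hw
      rwa [h0, add_zero] at this

end Tate

section

variable {Q ι : Type*} [CommRing Q] (N : Type*) [AddCommGroup N] [Module Q N]

/-- The tensor product of `N` with the free module of functions supported in `s`. -/
noncomputable def supportedTensorEquiv (s : Set ι) :
    Finsupp.supported Q Q s ⊗[Q] N ≃ₗ[Q] Finsupp.supported N Q s :=
  (Finsupp.supportedEquivFinsupp s).rTensor N ≪≫ₗ tensorEquiv Q s N ≪≫ₗ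
    (Finsupp.supportedEquivFinsupp s).symm

theorem coe_supportedTensorEquiv (s : Set ι) (t : Finsupp.supported Q Q s ⊗[Q] N) :
    (supportedTensorEquiv N s t : ι →₀ N) =
      tensorEquiv Q ι N ((Finsupp.supported Q Q s).subtype.rTensor N t) := by
  induction t with
  | zero => simp
  | add t t' ht ht' => rw [map_add, Submodule.coe_add, ht, ht', map_add, map_add]
  | tmul w y =>
    classical
    ext j
    rw [LinearMap.rTensor_tmul, tensorEquiv_tmul_apply, supportedTensorEquiv]
    simp only [LinearEquiv.trans_apply, LinearEquiv.rTensor_tmul,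
      Finsupp.supportedEquivFinsupp_symm_apply_coe]
    by_cases hj : j ∈ s
    · rw [Finsupp.extendDomain_apply, dif_pos hj, tensorEquiv_tmul_apply]
      rfl
    · have : (w : ι →₀ Q) j = 0 := Finsupp.notMem_support_iff.1 fun h' => hj (w.2 h')
      rw [Finsupp.extendDomain_apply, dif_neg hj, Submodule.subtype_apply, this, zero_smul]

variable (Q) in
/-- Functions on the domain of an injective map, as functions supported in its range. -/
noncomputable def supportedRangeEquiv {κ : Type*} (j : κ → ι) (hj : Function.Injective j) :
    (κ →₀ N) ≃ₗ[Q] Finsupp.supported N Q (Set.range j) :=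
  Finsupp.domLCongr (Equiv.ofInjective j hj) ≪≫ₗ (Finsupp.supportedEquivFinsupp (Set.range j)).symm

variable {N} in
theorem coe_supportedRangeEquiv_single {κ : Type*} (j : κ → ι) (hj : Function.Injective j)
    (s : κ) (y : N) :
    (supportedRangeEquiv Q N j hj (Finsupp.single s y) : ι →₀ N) = Finsupp.single (j s) y := by
  simp [supportedRangeEquiv]

variable {N} in
theorem supportedRangeEquiv_apply {κ : Type*} (j : κ → ι) (hj : Function.Injective j)
    (v : κ →₀ N) (s : κ) : (supportedRangeEquiv Q N j hj v : ι →₀ N) (j s) = v s := by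
  classical
  induction v using Finsupp.induction_linear with
  | zero => simp
  | add v v' hv hv' => simp [hv, hv']
  | single t y =>
    rw [coe_supportedRangeEquiv_single, Finsupp.single_apply, Finsupp.single_apply]
    simp [hj.eq_iff]

end

theorem torLength_succ_of_equiv {A : Type u} [CommRing A] {M : Type u} [AddCommGroup M]
    [Module A M] (N : Type u) [AddCommGroup N] [Module A N] (X : ℕ → Type u)
    [∀ n, AddCommGroup (X n)] [∀ n, Module A (X n)] [∀ n, Module.Projective A (X n)]
    (d : ∀ n, X (n + 1) →ₗ[A] X n) (ε : X 0 →ₗ[A] M) (hε : Function.Surjective ε)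
    (h₀ : Function.Exact (d 0) ε) (h : ∀ n, Function.Exact (d (n + 1)) (d n))
    {Y : ℕ → Type*} [∀ n, AddCommGroup (Y n)] [∀ n, Module A (Y n)]
    (d' : ∀ n, Y (n + 1) →ₗ[A] Y n) (E : ∀ n, X n ⊗[A] N ≃ₗ[A] Y n)
    (hE : ∀ n t, E n ((d n).rTensor N t) = d' n (E (n + 1) t)) (n : ℕ) :
    torLength A M N (n + 1) = homologyLength (d' (n + 1)) (d' n) := by
  rw [torLength_succ N X d ε hε h₀ h]
  exact homologyLength_congr (B := A) Function.surjective_id (E (n + 2)).toAddEquiv (E (n + 1))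
    (E n).toAddEquiv (hE (n + 1)) (hE n)

namespace Tate

variable {Q : Type u} [CommRing Q] {S : ℕ → Type u} {f g : Q}
  {d : ∀ n, (S (n + 1) →₀ Q ⧸ Ideal.span {f}) →ₗ[Q ⧸ Ideal.span {f}]
    (S n →₀ Q ⧸ Ideal.span {f})}
  {φ : (Σ n, S n) → (Index S →₀ Q)}

theorem exact_D (h : ∀ n, IsTwist d g φ n) (hfg : IsExactPair f g)
    (hunit : ∀ i : ℕ, IsUnit ((i + 1 : ℕ) : Q)) {m : ℕ} {w : Index S →₀ Q}
    (hw : w ∈ G Q S m) (hD : D f g φ w = 0) {v : S (m + 1) →₀ Q ⧸ Ideal.span {f}}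
    (hv : d m v = proj f m w) : ∃ v ∈ G Q S (m + 1), D f g φ v = w := by
  have hfg0 : f * g = 0 := (hfg.ann_right f).2 (Ideal.mem_span_singleton_self f)
  obtain ⟨u, hu, rfl⟩ := exists_lift (m + 1) v
  have hDu : D f g φ u ∈ G Q S m := D_mem_G h hu
  obtain ⟨u', hu', -, hDu'⟩ := (h (m + 1)).exists_preimage (w := w - D f g φ u) hfg hunit le_rfl
    (sub_mem hw hDu) (G_le_W (Nat.lt_succ_self _) (sub_mem hw hDu))
    (by rw [map_sub, hD, (h (m + 2)).D_D hfg0 (G_le_W (Nat.lt_succ_self _) hu), sub_zero])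
    (by rw [map_sub, (h (m + 2)).proj_D hu (G_le_W (Nat.lt_succ_self _) hu), hv, sub_self])
  exact ⟨u + u', add_mem hu hu'.1, by rw [map_add, hDu', add_sub_cancel]⟩

theorem modYZ_apply (w : Index S →₀ Q) (x : Σ n, S n) :
    modYZ w (0, false, x) = w (0, false, x) := by
  classical
  have : Finsupp.lapply (0, false, x) ∘ₗ modYZ =
      (Finsupp.lapply (0, false, x) : (Index S →₀ Q) →ₗ[Q] Q) :=
    hom_ext fun i ε x' => by cases i <;> cases ε <;> simp
  exact LinearMap.congr_fun this w

variable {M : Type u} [AddCommGroup M] [Module (Q ⧸ Ideal.span {f}) M]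
  (N : Type u) [AddCommGroup N] [Module Q N]

set_option maxHeartbeats 1600000 in
theorem torLength_eq_total [Module Q M] [IsScalarTower Q (Q ⧸ Ideal.span {f}) M]
    (h : ∀ n, IsTwist d g φ n) (hfg : IsExactPair f g)
    (hfg0 : f * g = 0) (hunit : ∀ i : ℕ, IsUnit ((i + 1 : ℕ) : Q))
    (ε : (S 0 →₀ Q ⧸ Ideal.span {f}) →ₗ[Q ⧸ Ideal.span {f}] M) (hε : Function.Surjective ε)
    (h₀ : Function.Exact (d 0) ε) (hd : ∀ n, Function.Exact (d (n + 1)) (d n)) (n : ℕ) :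
    torLength Q M N (n + 1) = (total N h hfg0).length n := by
  let dG (n : ℕ) : G Q S (n + 1) →ₗ[Q] G Q S n := (D f g φ).restrict fun w hw => D_mem_G h hw
  let εG : G Q S 0 →ₗ[Q] M := ε.restrictScalars Q ∘ₗ proj f 0 ∘ₗ (G Q S 0).subtype
  have hproj (n : ℕ) (w : G Q S (n + 1)) :
      proj f n (D f g φ w) = d n (proj f (n + 1) w) :=
    (h (n + 2)).proj_D w.2 (G_le_W (Nat.lt_succ_self _) w.2)
  have hεG : Function.Surjective εG := by
    intro x
    obtain ⟨v, rfl⟩ := hε x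
    obtain ⟨w, hw, rfl⟩ := exists_lift 0 v
    exact ⟨⟨w, hw⟩, rfl⟩
  have h₀G : Function.Exact (dG 0) εG := by
    intro w
    constructor
    · intro hw
      obtain ⟨v, hv⟩ := (h₀ _).1 hw
      obtain ⟨u, hu, huw⟩ := exact_D h hfg hunit w.2 (D_eq_zero h w.2) hv
      exact ⟨⟨u, hu⟩, Subtype.ext huw⟩
    · rintro ⟨u, rfl⟩
      change ε (proj f 0 (D f g φ u)) = 0
      rw [hproj 0 u]
      exact h₀.apply_apply_eq_zero _
  have hdG (n : ℕ) : Function.Exact (dG (n + 1)) (dG n) := by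
    intro w
    constructor
    · intro hw
      have hDw : D f g φ w = 0 := congrArg Subtype.val hw
      obtain ⟨v, hv⟩ := (hd n (proj f (n + 1) w)).1 (by rw [← hproj n w, hDw, map_zero])
      obtain ⟨u, hu, huw⟩ := exact_D h hfg hunit w.2 hDw hv
      exact ⟨⟨u, hu⟩, Subtype.ext huw⟩
    · rintro ⟨u, rfl⟩
      exact Subtype.ext (LinearMap.congr_fun (D_comp_D h hfg0) u.1)
  have : ∀ n, Module.Projective Q (G Q S n) := fun n =>
    Module.Projective.of_equiv (Finsupp.supportedEquivFinsupp {j : Index S | deg j = n}).symm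
  let E (n : ℕ) : G Q S n ⊗[Q] N ≃ₗ[Q] (total N h hfg0).gr n :=
    supportedTensorEquiv N _
  have hE (n : ℕ) (t : G Q S n ⊗[Q] N) : (E n t : Index S →₀ N) =
      tensorEquiv Q _ N ((G Q S n).subtype.rTensor N t) :=
    coe_supportedTensorEquiv N _ t
  have hcomm (n : ℕ) (t : G Q S (n + 1) ⊗[Q] N) :
      E n ((dG n).rTensor N t) = (total N h hfg0).d n (E (n + 1) t) := by
    refine Subtype.ext ?_
    rw [hE, GradedDifferential.coe_d, hE, total_diff, coeffMap_tensorEquiv,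
      ← LinearMap.comp_apply, ← LinearMap.comp_apply, ← LinearMap.rTensor_comp,
      ← LinearMap.rTensor_comp]
    rfl
  exact torLength_succ_of_equiv N (fun n => G Q S n) dG εG hεG h₀G hdG (total N h hfg0).d E hcomm n

variable [Module (Q ⧸ Ideal.span {f}) N] [IsScalarTower Q (Q ⧸ Ideal.span {f}) N]

theorem torLength_eq_quotYZ (h : ∀ n, IsTwist d g φ n)
    (hfg0 : f * g = 0) (hf : ∀ y : N, f • y = 0) (hg : ∀ y : N, g • y = 0)
    (ε : (S 0 →₀ Q ⧸ Ideal.span {f}) →ₗ[Q ⧸ Ideal.span {f}] M) (hε : Function.Surjective ε)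
    (h₀ : Function.Exact (d 0) ε) (hd : ∀ n, Function.Exact (d (n + 1)) (d n)) (n : ℕ) :
    torLength (Q ⧸ Ideal.span {f}) M N (n + 1) = (quotYZ N h hfg0 hf hg).length n := by
  rw [torLength_succ N (fun n => S n →₀ Q ⧸ Ideal.span {f}) d ε hε h₀ hd]
  have hinj (n : ℕ) : Function.Injective (baseIndex S n) := fun s t h => by
    simpa [baseIndex] using h
  let B (n : ℕ) : (S n →₀ N) ≃ₗ[Q] (quotYZ N h hfg0 hf hg).gr n :=
    supportedRangeEquiv Q N (baseIndex S n) (hinj n)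
  let C (n : ℕ) : (S n →₀ N) ≃ₗ[Q] (S n →₀ Q ⧸ Ideal.span {f}) ⊗[Q ⧸ Ideal.span {f}] N :=
    (tensorEquiv (Q ⧸ Ideal.span {f}) (S n) N).symm.restrictScalars Q
  have hB (n : ℕ) (s : S n) (y : N) :
      (B n (Finsupp.single s y) : Index S →₀ N) = Finsupp.single (baseIndex S n s) y :=
    coe_supportedRangeEquiv_single _ (hinj n) s y
  have hB' (n : ℕ) (v : S n →₀ N) (s : S n) :
      (B n v : Index S →₀ N) (baseIndex S n s) = v s :=
    supportedRangeEquiv_apply _ (hinj n) v s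
  have hcomm (n : ℕ) (v : S (n + 1) →₀ N) :
      (quotYZ N h hfg0 hf hg).d n (B (n + 1) v) =
        B n ((C n).symm ((d n).rTensor N (C (n + 1) v))) := by
    induction v using Finsupp.induction_linear with
    | zero => simp
    | add v v' hv hv' => simp only [map_add, hv, hv']
    | single s y =>
      refine (B n).symm.injective ?_
      rw [LinearEquiv.symm_apply_apply]
      ext t
      rw [← hB', LinearEquiv.apply_symm_apply, GradedDifferential.coe_d, hB, quotYZ_diff,
        ← coeffMap_comp, coeffMap_single_apply]
      have hmk (q : Q) : q • y = Ideal.Quotient.mk (Ideal.span {f}) q • y :=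
        (algebraMap_smul (Q ⧸ Ideal.span {f}) q y).symm
      rw [LinearMap.comp_apply, D_false_zero, modYZ_apply, hmk, ← proj_apply,
        (h (n + 2)).lift n s (Nat.lt_succ_self _)]
      simp [C]
  refine (homologyLength_congr Ideal.Quotient.mk_surjective
    ((B (n + 2)).symm ≪≫ₗ C (n + 2)).toAddEquiv ((B (n + 1)).symm ≪≫ₗ C (n + 1))
    ((B n).symm ≪≫ₗ C n).toAddEquiv (fun x => ?_) (fun x => ?_)).symm
  · obtain ⟨x, rfl⟩ := (B (n + 2)).surjective x
    rw [hcomm]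
    simp
  · obtain ⟨x, rfl⟩ := (B (n + 1)).surjective x
    rw [hcomm]
    simp

end Tate

section Growth

open Asymptotics

theorem isTheta_natCast_add_zpow (k : ℕ) (z : ℤ) :
    (fun n : ℕ => ((n + k : ℕ) : ℝ) ^ z) =Θ[atTop] fun n : ℕ => (n : ℝ) ^ z := by
  refine IsTheta.zpow ⟨?_, ?_⟩ z
  · refine IsBigO.of_bound 2 ?_
    filter_upwards [eventually_ge_atTop k] with n hn
    rw [Real.norm_natCast, Real.norm_natCast]
    exact_mod_cast (by omega : n + k ≤ 2 * n)
  · refine IsBigO.of_bound 1 (Eventually.of_forall fun n => ?_)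
    rw [Real.norm_natCast, Real.norm_natCast]
    exact_mod_cast (by omega : n ≤ 1 * (n + k))

theorem Asymptotics.IsBigO.shift_zpow {a : ℕ → ℕ} {z : ℤ}
    (ha : (fun n => (a n : ℝ)) =O[atTop] fun n => (n : ℝ) ^ z) (k : ℕ) :
    (fun n => (a (n + k) : ℝ)) =O[atTop] fun n => (n : ℝ) ^ z :=
  (ha.comp_tendsto (tendsto_add_atTop_nat k)).trans (isTheta_natCast_add_zpow k z).1

theorem Asymptotics.IsBigO.of_shift_zpow {a : ℕ → ℕ} {z : ℤ} {k : ℕ}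
    (ha : (fun n => (a (n + k) : ℝ)) =O[atTop] fun n => (n : ℝ) ^ z) :
    (fun n => (a n : ℝ)) =O[atTop] fun n => (n : ℝ) ^ z := by
  rw [← map_add_atTop_eq_nat k, isBigO_map]
  exact ha.trans (isTheta_natCast_add_zpow k z).2

/-- A sequence does not grow faster than its second differences of step two, up to one degree. -/
theorem isBigO_of_le_add {a s : ℕ → ℕ} (h : ∀ n, a (n + 2) ≤ a n + s n) {c : ℕ}
    (hs : (fun n => (s n : ℝ)) =O[atTop] fun n => (n : ℝ) ^ ((c : ℤ) - 1)) :
    (fun n => (a n : ℝ)) =O[atTop] fun n => (n : ℝ) ^ (((c + 1 : ℕ) : ℤ) - 1) := by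
  have hc : (((c + 1 : ℕ) : ℤ) - 1) = (c : ℤ) := by push_cast; ring
  simp only [hc, zpow_natCast]
  obtain ⟨α, hα, hs⟩ := hs.exists_pos
  have hdiff : ∀ᶠ n : ℕ in atTop, (s n : ℝ) ≤ α * ((n + 2 : ℕ) : ℝ) ^ c - α * (n : ℝ) ^ c := by
    rcases c with _ | c
    · filter_upwards [hs.bound, eventually_gt_atTop ⌈α⌉₊] with n hn hαn
      have hαn : α < n := Nat.lt_of_ceil_lt hαn
      have hlt : (s n : ℝ) < 1 := by
        refine lt_of_le_of_lt (by simpa using hn) ?_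
        rw [← div_eq_mul_inv, div_lt_one (hα.trans hαn)]
        exact hαn
      have : s n = 0 := by
        have : s n < 1 := by exact_mod_cast hlt
        omega
      simp [this]
    · filter_upwards [hs.bound] with n hn
      have hn : (s n : ℝ) ≤ α * (n : ℝ) ^ c := by simpa using hn
      have h1 : (n : ℝ) ^ c ≤ ((n + 2 : ℕ) : ℝ) ^ c := by gcongr; omega
      refine hn.trans ?_
      rw [← mul_sub]
      refine mul_le_mul_of_nonneg_left ?_ hα.le
      have h2 : (n : ℝ) ^ c * n ≤ ((n + 2 : ℕ) : ℝ) ^ c * n :=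
        mul_le_mul_of_nonneg_right h1 n.cast_nonneg
      have h3 : 0 ≤ (n : ℝ) ^ c := by positivity
      rw [pow_succ, pow_succ]
      push_cast at *
      nlinarith
  obtain ⟨m, hm⟩ := eventually_atTop.1 hdiff
  let B : ℝ := (a m : ℝ) + a (m + 1)
  have key (n : ℕ) : (a (m + n) : ℝ) ≤ B + α * ((m + n : ℕ) : ℝ) ^ c := by
    induction n using Nat.twoStepInduction with
    | zero =>
      have : 0 ≤ α * ((m + 0 : ℕ) : ℝ) ^ c := by positivity
      have : (0 : ℝ) ≤ a (m + 1) := by positivity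
      simp only [B, add_zero] at *
      linarith
    | one =>
      have : 0 ≤ α * ((m + 1 : ℕ) : ℝ) ^ c := by positivity
      have : (0 : ℝ) ≤ a m := by positivity
      simp only [B] at *
      linarith
    | more n ih _ =>
      have h1 : (a (m + n + 2) : ℝ) ≤ a (m + n) + s (m + n) := by exact_mod_cast h (m + n)
      have h2 := hm (m + n) (by omega)
      rw [← add_assoc]
      linarith
  refine IsBigO.of_bound (B + α) ?_
  filter_upwards [eventually_ge_atTop m, eventually_ge_atTop 1] with n hn hn1
  obtain ⟨k, rfl⟩ := Nat.exists_eq_add_of_le hn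
  have h1 : (1 : ℝ) ≤ ((m + k : ℕ) : ℝ) ^ c := one_le_pow₀ (by exact_mod_cast hn1)
  have hB : 0 ≤ B := by positivity
  rw [Real.norm_natCast, Real.norm_of_nonneg (by positivity)]
  have := key k
  nlinarith

theorem seriesComplexity_eq (p : PowerSeries ℝ) :
    seriesComplexity p = sInf {x : ℕ∞ | ∃ c : ℕ, x = c ∧
      (fun n => PowerSeries.coeff n p) =O[atTop] fun n => (n : ℝ) ^ ((c : ℤ) - 1)} := by
  unfold seriesComplexity
  congr! 6 with x c
  rw [isBigO_iff']
  simp [Real.norm_eq_abs]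

theorem seriesComplexity_le_add_one {p q : PowerSeries ℝ}
    (h : ∀ c : ℕ, ((fun n => PowerSeries.coeff n q) =O[atTop] fun n => (n : ℝ) ^ ((c : ℤ) - 1)) →
      (fun n => PowerSeries.coeff n p) =O[atTop] fun n => (n : ℝ) ^ (((c + 1 : ℕ) : ℤ) - 1)) :
    seriesComplexity p ≤ seriesComplexity q + 1 := by
  rw [seriesComplexity_eq p, seriesComplexity_eq q]
  by_cases hne : {x : ℕ∞ | ∃ c : ℕ, x = c ∧
      (fun n => PowerSeries.coeff n q) =O[atTop] fun n => (n : ℝ) ^ ((c : ℤ) - 1)}.Nonempty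
  · obtain ⟨c, hc, hq⟩ := csInf_mem hne
    rw [hc]
    exact sInf_le ⟨c + 1, by push_cast; rfl, h c hq⟩
  · rw [Set.not_nonempty_iff_eq_empty.1 hne, sInf_empty, top_add]
    exact le_top

end Growth

theorem torLength_ne_top {A M N : Type u} [CommRing A] [IsNoetherianRing A] [AddCommGroup M]
    [AddCommGroup N] [Module A M] [Module A N] [Module.Finite A M] [Module.Finite A N]
    (hMN : Module.length A (M ⊗[A] N) ≠ ⊤) (n : ℕ) : torLength A M N n ≠ ⊤ := by
  obtain ⟨S, hS, d, ε, hε, h₀, h⟩ := exists_free_resolution A M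
  have := finite_tor' N (moduleResolution (fun n => S n →₀ A) d ε hε h₀ h)
    (fun n => inferInstanceAs (Module.Finite A (S n →₀ A))) n
  exact Module.length_ne_top_of_annihilator_le hMN (annihilator_left_le_annihilator_tor' N n)
    (annihilator_right_le_annihilator_tor' N n)

theorem IsLocalRing.isUnit_natCast_succ {Q : Type*} [CommRing Q] [IsLocalRing Q]
    [CharZero (IsLocalRing.ResidueField Q)] (i : ℕ) : IsUnit ((i + 1 : ℕ) : Q) := by
  by_contra h
  have h0 := (IsLocalRing.residue_eq_zero_iff _).2 ((IsLocalRing.mem_maximalIdeal _).2 h)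
  rw [map_natCast, Nat.cast_eq_zero] at h0
  omega

theorem Module.length_tensorProduct_ne_top_of_surjective {A B M N : Type*} [CommRing A]
    [CommRing B] [Algebra A B] [AddCommGroup M] [AddCommGroup N] [Module A M] [Module A N]
    [Module B M] [Module B N] [IsScalarTower A B M] [IsScalarTower A B N]
    (hAB : Function.Surjective (algebraMap A B)) (h : Module.length A (M ⊗[A] N) ≠ ⊤) :
    Module.length B (M ⊗[B] N) ≠ ⊤ := by
  rw [← Module.length_eq_of_surjective (R := B) (S := A) hAB]
  let π : M ⊗[A] N →ₗ[A] M ⊗[B] N := TensorProduct.lift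
    (LinearMap.mk₂ A (fun x y => x ⊗ₜ[B] y) (fun _ _ _ => TensorProduct.add_tmul _ _ _)
      (fun a x y => by rw [← algebraMap_smul B a x, ← algebraMap_smul B a (x ⊗ₜ[B] y)]; rfl)
      (fun _ _ _ => TensorProduct.tmul_add _ _ _)
      (fun a x y => by
        rw [← algebraMap_smul B a y, ← algebraMap_smul B a (x ⊗ₜ[B] y), TensorProduct.tmul_smul]))
  refine ne_top_of_le_ne_top h (Module.length_le_of_surjective π fun t => ?_)
  induction t with
  | zero => exact ⟨0, map_zero _⟩
  | add t t' ht ht' =>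
    obtain ⟨u, rfl⟩ := ht
    obtain ⟨u', rfl⟩ := ht'
    exact ⟨u + u', map_add _ _ _⟩
  | tmul x y => exact ⟨x ⊗ₜ y, rfl⟩

/-- The recursive inequalities between the lengths of the Tor modules over `Q` and `Q ⧸ (f)`. -/
theorem torLength_le_torLength {Q : Type u} [CommRing Q] [IsNoetherianRing Q] {f g : Q}
    (hfg : IsExactPair f g) (hunit : ∀ i : ℕ, IsUnit ((i + 1 : ℕ) : Q))
    (M N : Type u) [AddCommGroup M] [AddCommGroup N] [Module Q M] [Module Q N]
    [Module (Q ⧸ Ideal.span {f}) M] [Module (Q ⧸ Ideal.span {f}) N]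
    [IsScalarTower Q (Q ⧸ Ideal.span {f}) M] [IsScalarTower Q (Q ⧸ Ideal.span {f}) N]
    [Module.Finite (Q ⧸ Ideal.span {f}) M] (hgN : ∀ x : N, g • x = 0) (n : ℕ) :
    torLength Q M N (n + 3) ≤ torLength Q M N (n + 1) +
      (torLength (Q ⧸ Ideal.span {f}) M N (n + 2) + torLength (Q ⧸ Ideal.span {f}) M N (n + 3)) ∧
    torLength (Q ⧸ Ideal.span {f}) M N (n + 4) ≤ torLength (Q ⧸ Ideal.span {f}) M N (n + 2) +
      (torLength Q M N (n + 4) + torLength Q M N (n + 1)) := by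
  obtain ⟨S, -, d, ε, hε, h₀, hd⟩ := exists_free_resolution (Q ⧸ Ideal.span {f}) M
  have hfN (y : N) : f • y = 0 := by
    rw [← algebraMap_smul (Q ⧸ Ideal.span {f}) f y, Ideal.Quotient.algebraMap_eq,
      Ideal.Quotient.eq_zero_iff_mem.2 (Ideal.mem_span_singleton_self f), zero_smul]
  have hfg0 : f * g = 0 := (hfg.ann_right f).2 (Ideal.mem_span_singleton_self f)
  obtain ⟨φ, h⟩ := Tate.exists_isTwist hfg hunit fun n v => (hd n).apply_apply_eq_zero v
  have hQ := Tate.torLength_eq_total N h hfg hfg0 hunit ε hε h₀ hd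
  have hR := Tate.torLength_eq_quotYZ N h hfg0 hfN hgN ε hε h₀ hd
  obtain ⟨hz, hz'⟩ := Tate.length_quotZ N h hfg0 hgN n
  obtain ⟨hyz, -⟩ := Tate.length_quotYZ N h hfg0 hfN hgN (n + 1)
  obtain ⟨-, hyz'⟩ := Tate.length_quotYZ N h hfg0 hfN hgN (n + 1)
  rw [hQ n, hQ (n + 2), hR (n + 1), hR (n + 2), hQ (n + 3), hR (n + 3)]
  refine ⟨hz.trans (add_le_add_right hyz _), hyz'.trans ?_⟩
  rw [add_comm]
  exact add_le_add_right hz' _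

theorem mainTheorem3 {Q : Type u} [CommRing Q] [IsLocalRing Q] [IsNoetherianRing Q]
    [CharZero (IsLocalRing.ResidueField Q)] (f g : Q) (hfg : IsExactPair f g)
    (M N : Type u) [AddCommGroup M] [AddCommGroup N] [Module Q M] [Module Q N]
    [Module (Q ⧸ Ideal.span {f}) M] [Module (Q ⧸ Ideal.span {f}) N]
    [IsScalarTower Q (Q ⧸ Ideal.span {f}) M] [IsScalarTower Q (Q ⧸ Ideal.span {f}) N]
    [Module.Finite (Q ⧸ Ideal.span {f}) M] [Module.Finite (Q ⧸ Ideal.span {f}) N]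
    (hgN : ∀ x : N, g • x = 0) (hMN : Module.length Q (M ⊗[Q] N) ≠ ⊤) :
    (∀ n : ℕ, torLength Q M N n ≠ ⊤) ∧
    (∀ n : ℕ, torLength (Q ⧸ Ideal.span {f}) M N n ≠ ⊤) ∧
    lengthComplexity Q M N - 1 ≤ lengthComplexity (Q ⧸ Ideal.span {f}) M N ∧
    lengthComplexity (Q ⧸ Ideal.span {f}) M N ≤ lengthComplexity Q M N + 1 := by
  have : Module.Finite Q M := Module.Finite.trans (Q ⧸ Ideal.span {f}) M
  have : Module.Finite Q N := Module.Finite.trans (Q ⧸ Ideal.span {f}) N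
  have hQ := torLength_ne_top hMN
  have hR := torLength_ne_top (A := Q ⧸ Ideal.span {f}) (M := M) (N := N)
    (Module.length_tensorProduct_ne_top_of_surjective Ideal.Quotient.mk_surjective hMN)
  have hle := torLength_le_torLength hfg IsLocalRing.isUnit_natCast_succ M N hgN
  let a (n : ℕ) : ℕ := (torLength Q M N n).toNat
  let b (n : ℕ) : ℕ := (torLength (Q ⧸ Ideal.span {f}) M N n).toNat
  have ha (n : ℕ) : torLength Q M N n = a n := (ENat.natCast_toNat (hQ n)).symm
  have hb (n : ℕ) : torLength (Q ⧸ Ideal.span {f}) M N n = b n := (ENat.natCast_toNat (hR n)).symm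
  simp only [ha, hb] at hle
  have hab (n : ℕ) : a (n + 3) ≤ a (n + 1) + (b (n + 2) + b (n + 3)) := by
    exact_mod_cast (hle n).1
  have hba (n : ℕ) : b (n + 4) ≤ b (n + 2) + (a (n + 4) + a (n + 1)) := by
    exact_mod_cast (hle n).2
  refine ⟨hQ, hR, tsub_le_iff_right.2 ?_, ?_⟩
  · refine seriesComplexity_le_add_one fun c hc => ?_
    simp only [poincareSeries, PowerSeries.coeff_mk] at hc ⊢
    refine Asymptotics.IsBigO.of_shift_zpow (a := a) (k := 1) (isBigO_of_le_add hab ?_)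
    push_cast
    exact (hc.shift_zpow 2).add (hc.shift_zpow 3)
  · refine seriesComplexity_le_add_one fun c hc => ?_
    simp only [poincareSeries, PowerSeries.coeff_mk] at hc ⊢
    refine Asymptotics.IsBigO.of_shift_zpow (a := b) (k := 2) (isBigO_of_le_add hba ?_)
    push_cast
    exact (hc.shift_zpow 4).add (hc.shift_zpow 1)
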